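/- Call $\Psi\colon[0,\infty)\to[0,\infty)$ an Orlicz function if it is convex, strictly increasing and $\Psi(0)=0$, and define $\psi\colon[0,\infty)\to[0,\infty)$ by $\Psi(x)=e^{\psi(x)}-1$. Say that $\Psi$ satisfies condition (HJ) if there is a constant $K>0$ such that for all $s,u\ge K$, $$\psi(su)\le K\bigl(s\ln(1+s)+s\,\psi(u)\bigr).$$ On a probability space $(\Omega,\mathcal F,\mathbb P)$, a random variable with values in a Banach space $(F,\|\cdot\|)$ means a Borel measurable map $X\colon\Omega\to F$ with values in a separable subspace of $F$. Put $\|X\|_\Psi=\inf\{a>0:\ \mathbb E\,\Psi(\|X\|/a)\le 1\}$ (with $\inf\emptyset=\infty$), and let $L_\Psi$ be the set of random variables $X$ with $\|X\|_\Psi<\infty$. For random variables with values in $[0,\infty]$ (such as suprema) the same definitions are used, with absolute value in place of the norm and with $\Psi(\infty)=\infty$. **Theorem.** Let $X_n$, $n\ge1$, be independent random variables with values in a Banach space $(F,\|\cdot\|)$, let $S_n=X_1+\dots+X_n$, and let $\Psi$ be an Orlicz function satisfying (HJ). Suppose that $(S_n)_{n\ge1}$ is stochastically bounded, i.e. for every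 $\varepsilon>0$ there is $K>0$ such that $\mathbb P(\|S_n\|\ge K)<\varepsilon$ for all $n\ge1$. Then the following conditions are equivalent: (i) $(S_n)_{n\ge1}$ is bounded in $L_\Psi$, i.e. $\sup_n\|S_n\|_\Psi<\infty$; (ii) $\sup_n\|X_n\|\in L_\Psi$; (iii) $\sup_n\|S_n\|\in L_\Psi$. -/

import Mathlib

open MeasureTheory ProbabilityTheory
open scoped NNReal ENNReal

noncomputable section

/-- An Orlicz function `Ψ : [0,∞) → [0,∞)`: convex, strictly increasing, with `Ψ 0 = 0`. -/
structure IsOrliczFunction (Ψ : ℝ≥0 → ℝ≥0) : Prop where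
  convex : ConvexOn ℝ≥0 Set.univ Ψ
  strictMono : StrictMono Ψ
  map_zero : Ψ 0 = 0

/-- The function `ψ` determined by `Ψ x = exp (ψ x) - 1`, that is, `ψ x = log (1 + Ψ x)`. -/
def orliczExponent (Ψ : ℝ≥0 → ℝ≥0) (x : ℝ≥0) : ℝ :=
  Real.log (1 + (Ψ x : ℝ))

/-- The condition (HJ): there is `K > 0` such that for all `s, u ≥ K`,
`ψ (s u) ≤ K (s log (1 + s) + s ψ u)`. -/
def SatisfiesHJ (Ψ : ℝ≥0 → ℝ≥0) : Prop :=
  ∃ K : ℝ, 0 < K ∧ ∀ s u : ℝ≥0, K ≤ (s : ℝ) → K ≤ (u : ℝ) →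
    orliczExponent Ψ (s * u) ≤ K * ((s : ℝ) * Real.log (1 + (s : ℝ)) + (s : ℝ) * orliczExponent Ψ u)

/-- The extension of `Ψ` to `[0,∞]` by `Ψ ∞ = ∞`. -/
def orliczExtend (Ψ : ℝ≥0 → ℝ≥0) (y : ℝ≥0∞) : ℝ≥0∞ :=
  if y = ∞ then ∞ else (Ψ y.toNNReal : ℝ≥0∞)

/-- The (extended) Orlicz norm `‖X‖_Ψ = inf {a > 0 : 𝔼 Ψ (‖X‖ / a) ≤ 1}`, equal to `∞` if there is
no such `a`. It applies both to vector valued `X` and to `[0,∞]`-valued `X` (for which `‖x‖ₑ = x`). -/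
def eOrliczNorm {Ω E : Type*} [MeasurableSpace Ω] [ENorm E]
    (Ψ : ℝ≥0 → ℝ≥0) (X : Ω → E) (μ : Measure Ω) : ℝ≥0∞ :=
  ⨅ (a : ℝ≥0) (_ : 0 < a) (_ : ∫⁻ ω, orliczExtend Ψ (‖X ω‖ₑ / (a : ℝ≥0∞)) ∂μ ≤ 1), (a : ℝ≥0∞)

/-- `X ∈ L_Ψ`: `X` is a Radon random variable (Borel measurable with separable range, which is
strong measurability) and `‖X‖_Ψ < ∞`. -/
def MemOrlicz {Ω E : Type*} [MeasurableSpace Ω] [TopologicalSpace E] [ENorm E]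
    (Ψ : ℝ≥0 → ℝ≥0) (X : Ω → E) (μ : Measure Ω) : Prop :=
  StronglyMeasurable X ∧ eOrliczNorm Ψ X μ < ∞

/-- The sequence `Y` is bounded in `L_Ψ`. -/
def BoundedInOrlicz {Ω E : Type*} [MeasurableSpace Ω] [TopologicalSpace E] [ENorm E]
    (Ψ : ℝ≥0 → ℝ≥0) (Y : ℕ → Ω → E) (μ : Measure Ω) : Prop :=
  ∃ C : ℝ≥0, ∀ n, MemOrlicz Ψ (Y n) μ ∧ eOrliczNorm Ψ (Y n) μ ≤ (C : ℝ≥0∞)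

/-- Stochastic boundedness: for every `ε > 0` there is `K > 0` with `ℙ (‖Y n‖ ≥ K) < ε` for all
`n`. -/
def StochasticallyBounded {Ω F : Type*} [MeasurableSpace Ω] [Norm F]
    (Y : ℕ → Ω → F) (μ : Measure Ω) : Prop :=
  ∀ ε : ℝ, 0 < ε → ∃ K : ℝ, 0 < K ∧ ∀ n, μ.real {ω | K ≤ ‖Y n ω‖} < ε

/-- The partial sums of the sequence `X 0, X 1, …`; `partialSum X n = X 0 + ⋯ + X n`. -/
def partialSum {Ω F : Type*} [AddCommMonoid F] (X : ℕ → Ω → F) (n : ℕ) (ω : Ω) : F :=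
  ∑ i ∈ Finset.range (n + 1), X i ω

end

/-! The implications out of (iii) are elementary: `‖S_n‖` is at most the supremum, and `X_n` is a
difference of two partial sums. For (i) ⇒ (iii), stochastic boundedness makes every block sum at
most some `r` with probability at least 1/2, uniformly, so Ottaviani's inequality (`ottaviani`,
`lintegral_maxSum_sub_le`) bounds moments of the maximal partial sum by those of the last one.

The substance, and the only use of (HJ), is (ii) ⇒ (iii). Fix `t` such that, for every `n`, with
probability at least 1/2 no block inside `[0, n)` has a sum of norm above `t`. Pointwise, the
maximal partial sum is at most `T + U`, where `T` adds the norms of the summands larger than `t`,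
and an excess `U` of order `m * 2t` forces about `m` disjoint oscillations larger than `t`
(`hasOscCount_of_lt_norm`).

The excess: by independence, `m` oscillations have probability at most `1 / m!`
(`measureReal_hasOscCount_le`), while (HJ) limits `Ψ` at multiples of a small constant to a growth
`exp (m/2 * log (1 + 2m))`, which is summable against `1 / m!`.

The large summands: either one of them is comparable with `T`, and the maximal summand controls `Ψ`
of `T`, or averaging (HJ) over the summands bounds it by the same growth rate plus `∏ (1 + Ψ (y i))`
(`IsOrliczFunction.map_sum_le`). The product has bounded expectation by independence, because the
expected weights of large summands add up to at most a multiple of `1 + 𝔼 Ψ (max ‖X i‖ / a)`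
(`sum_lintegral_bigWeight_le`). -/

/-! ### Oscillations of a deterministic sequence of partial sums -/

section Oscillation

variable {F : Type*} [NormedAddCommGroup F]

/-- Some block of the sequence `x` inside `[i, j)` has a sum of norm larger than `t`. -/
def HasOsc (t : ℝ) (x : ℕ → F) (i j : ℕ) : Prop :=
  ∃ a b, i ≤ a ∧ a ≤ b ∧ b ≤ j ∧ t < ‖∑ l ∈ Finset.Ico a b, x l‖

/-- There are `k` consecutive disjoint intervals inside `[0, n)` on each of which `x` has an
oscillation larger than `t`. -/
def HasOscCount (t : ℝ) (x : ℕ → F) : ℕ → ℕ → Prop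
  | 0, _ => True
  | k + 1, n => ∃ j ≤ n, HasOscCount t x k j ∧ HasOsc t x j n

variable {t : ℝ} {x : ℕ → F}

lemma HasOsc.mono {i j i' j' : ℕ} (h : HasOsc t x i j) (hi : i' ≤ i) (hj : j ≤ j') :
    HasOsc t x i' j' := by
  obtain ⟨a, b, h1, h2, h3, h4⟩ := h
  exact ⟨a, b, hi.trans h1, h2, h3.trans hj, h4⟩

lemma HasOscCount.mono {k m n : ℕ} (h : HasOscCount t x k m) (hmn : m ≤ n) :
    HasOscCount t x k n := by
  cases k with
  | zero => trivial
  | succ k =>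
    obtain ⟨j, hj, h1, h2⟩ := h
    exact ⟨j, hj.trans hmn, h1, h2.mono le_rfl hmn⟩

/-- The sum of the norms, over the first `n` terms, of those terms of norm larger than `t`. -/
noncomputable def bigSum (t : ℝ) (x : ℕ → F) (n : ℕ) : ℝ :=
  ∑ i ∈ Finset.range n, if t < ‖x i‖ then ‖x i‖ else 0

lemma bigSum_mono (t : ℝ) (x : ℕ → F) : Monotone (bigSum t x) := by
  refine monotone_nat_of_le_succ fun n => ?_
  rw [bigSum, bigSum, Finset.sum_range_succ]
  have : 0 ≤ (if t < ‖x n‖ then ‖x n‖ else 0) := by split_ifs <;> positivity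
  linarith

lemma bigSum_nonneg (t : ℝ) (x : ℕ → F) (n : ℕ) : 0 ≤ bigSum t x n :=
  Finset.sum_nonneg fun i _ => by split_ifs <;> positivity

/-- Stop when the partial sum first passes the level for `k`. The last step overshoots by at most
`t` plus its own large part, which `bigSum` absorbs; the next level is `2 * t` higher, so more than
`t` is left for one further block. -/
lemma hasOscCount_of_lt_norm (ht : 0 ≤ t) (k : ℕ) : ∀ n,
    k * (2 * t) + t + bigSum t x n < ‖∑ i ∈ Finset.range n, x i‖ →
      HasOscCount t x (k + 1) n := by
  induction k with
  | zero =>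
    intro n hn
    refine ⟨0, Nat.zero_le _, trivial, 0, n, le_rfl, Nat.zero_le _, le_rfl, ?_⟩
    have := bigSum_nonneg t x n
    rw [← Finset.range_eq_Ico]
    simp only [Nat.cast_zero, zero_mul, zero_add] at hn
    linarith
  | succ k ih =>
    intro n hn
    classical
    have hex : ∃ j, k * (2 * t) + t + bigSum t x j < ‖∑ i ∈ Finset.range j, x i‖ :=
      ⟨n, by push_cast at hn; linarith⟩
    obtain ⟨hj, hmin⟩ := And.intro (Nat.find_spec hex) (fun m => Nat.find_min (H := hex) (m := m))
    have hjn : Nat.find hex ≤ n := Nat.find_min' hex (by push_cast at hn; linarith)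
    generalize Nat.find hex = j at hj hmin hjn
    refine ⟨j, hjn, ih j hj, j, n, le_rfl, hjn, le_rfl, ?_⟩
    cases j with
    | zero =>
      simp only [Finset.range_zero, Finset.sum_empty, norm_zero] at hj
      have := bigSum_nonneg t x 0
      have : (0 : ℝ) ≤ k * (2 * t) := by positivity
      linarith
    | succ j =>
      have h1 := hmin j (Nat.lt_succ_self j)
      rw [not_lt] at h1
      have h2 : ‖x j‖ ≤ t + (if t < ‖x j‖ then ‖x j‖ else 0) := by
        split_ifs with h
        · linarith
        · linarith [not_lt.1 h]
      have h3 : ‖∑ i ∈ Finset.range (j + 1), x i‖ ≤ k * (2 * t) + t + t + bigSum t x (j + 1) := by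
        rw [Finset.sum_range_succ, bigSum, Finset.sum_range_succ]
        rw [bigSum] at h1
        linarith [norm_add_le (∑ i ∈ Finset.range j, x i) (x j)]
      have h4 := bigSum_mono t x hjn
      rw [Finset.sum_Ico_eq_sub _ hjn]
      have h5 := norm_sub_norm_le (∑ i ∈ Finset.range n, x i) (∑ i ∈ Finset.range (j + 1), x i)
      push_cast at hn
      linarith

/-- Each large summand is an oscillation by itself, as a block of length one. -/
lemma hasOscCount_card (n : ℕ) : ∀ k ≤ ((Finset.range n).filter fun i => t < ‖x i‖).card,
    HasOscCount t x k n := by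
  induction n with
  | zero => intro k hk; simp at hk; subst hk; trivial
  | succ n ih =>
    intro k hk
    by_cases h : t < ‖x n‖
    · rw [Finset.range_add_one, Finset.filter_insert, if_pos h,
        Finset.card_insert_of_notMem (by simp)] at hk
      cases k with
      | zero => trivial
      | succ k =>
        exact ⟨n, n.le_succ, ih k (by omega), n, n + 1, le_rfl, n.le_succ, le_rfl, by simpa using h⟩
    · rw [Finset.range_add_one, Finset.filter_insert, if_neg h] at hk
      exact (ih k hk).mono n.le_succ

end Oscillation

/-! ### Independence of blocks -/

section Blocks

variable {Ω F : Type*} [MeasurableSpace F] {X : ℕ → Ω → F}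

/-- The σ-algebra generated by the `X i` with `i ∈ s`. -/
abbrev blockAlgebra (X : ℕ → Ω → F) (s : Set ℕ) : MeasurableSpace Ω :=
  ⨆ i ∈ s, MeasurableSpace.comap (X i) inferInstance

lemma blockAlgebra_mono (X : ℕ → Ω → F) {s u : Set ℕ} (h : s ⊆ u) :
    blockAlgebra X s ≤ blockAlgebra X u :=
  biSup_mono h

lemma measurableSet_disjointed_block {A : ℕ → Set Ω}
    (hA : ∀ j, MeasurableSet[blockAlgebra X (Set.Iio j)] (A j)) (j : ℕ) :
    MeasurableSet[blockAlgebra X (Set.Iio j)] (disjointed A j) := by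
  rw [disjointed_eq_inter_compl]
  refine MeasurableSet.inter (hA j) (MeasurableSet.iInter fun i => MeasurableSet.iInter fun hi => ?_)
  exact (blockAlgebra_mono X (Set.Iio_subset_Iio (le_of_lt hi)) _ (hA i)).compl

variable [MeasurableSpace Ω] {μ : Measure Ω}

lemma indep_blockAlgebra (hX : ∀ i, Measurable (X i)) (hindep : iIndepFun X μ) {s u : Set ℕ}
    (h : Disjoint s u) : Indep (blockAlgebra X s) (blockAlgebra X u) μ :=
  indep_iSup_of_disjoint (fun i => (hX i).comap_le) hindep.iIndep h

lemma measureReal_inter_block (hX : ∀ i, Measurable (X i)) (hindep : iIndepFun X μ) {j : ℕ}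
    {A B : Set Ω} (hA : MeasurableSet[blockAlgebra X (Set.Iio j)] A)
    (hB : MeasurableSet[blockAlgebra X (Set.Ici j)] B) :
    μ.real (A ∩ B) = μ.real A * μ.real B := by
  have h := (Indep_iff _ _ μ).1 (indep_blockAlgebra hX hindep
    (Set.disjoint_left.2 fun i (h1 : i < j) (h2 : j ≤ i) => by omega)) A B hA hB
  rw [measureReal_def, h, ENNReal.toReal_mul]; rfl

lemma blockAlgebra_le (hX : ∀ i, Measurable (X i)) (s : Set ℕ) :
    blockAlgebra X s ≤ ‹MeasurableSpace Ω› :=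
  iSup₂_le fun i _ => (hX i).comap_le

variable [NormedAddCommGroup F]

lemma stronglyMeasurable_blockAlgebra_sum [BorelSpace F] (hX : ∀ i, StronglyMeasurable (X i))
    {s : Set ℕ} (u : Finset ℕ) (hu : ∀ i ∈ u, i ∈ s) :
    StronglyMeasurable[blockAlgebra X s] fun ω => ∑ i ∈ u, X i ω := by
  refine Finset.stronglyMeasurable_fun_sum u fun i hi => ?_
  refine (stronglyMeasurable_iff_measurable_separable).2 ⟨?_, (hX i).isSeparable_range⟩
  exact Measurable.mono (comap_measurable (X i)) (le_iSup₂_of_le i (hu i hi) le_rfl) le_rfl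

lemma measurableSet_hasOsc [BorelSpace F] (hX : ∀ i, StronglyMeasurable (X i)) (t : ℝ) (i j : ℕ) :
    MeasurableSet[blockAlgebra X (Set.Ico i j)] {ω | HasOsc t (fun l => X l ω) i j} := by
  simp only [HasOsc]
  have : {ω | ∃ a b, i ≤ a ∧ a ≤ b ∧ b ≤ j ∧ t < ‖∑ l ∈ Finset.Ico a b, X l ω‖} =
      ⋃ (a : ℕ) (b : ℕ) (_ : i ≤ a ∧ a ≤ b ∧ b ≤ j),
        {ω | t < ‖∑ l ∈ Finset.Ico a b, X l ω‖} := by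
    ext ω
    simp only [Set.mem_ofPred_eq, Set.mem_iUnion, exists_prop, and_assoc]
  rw [this]
  refine MeasurableSet.iUnion fun a => MeasurableSet.iUnion fun b => MeasurableSet.iUnion fun h => ?_
  have hm := (stronglyMeasurable_blockAlgebra_sum (s := Set.Ico i j) hX (Finset.Ico a b)
    fun l hl => by
      rw [Finset.mem_Ico] at hl
      exact ⟨h.1.trans hl.1, hl.2.trans_le h.2.2⟩).norm.measurable
  exact hm measurableSet_Ioi

lemma measurableSet_hasOscCount [BorelSpace F] (hX : ∀ i, StronglyMeasurable (X i)) (t : ℝ)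
    (k : ℕ) : ∀ n,
    MeasurableSet[blockAlgebra X (Set.Iio n)] {ω | HasOscCount t (fun l => X l ω) k n} := by
  induction k with
  | zero => intro n; simp [HasOscCount]
  | succ k ih =>
    intro n
    have : {ω | HasOscCount t (fun l => X l ω) (k + 1) n} = ⋃ (j : ℕ) (_ : j ≤ n),
        ({ω | HasOscCount t (fun l => X l ω) k j} ∩ {ω | HasOsc t (fun l => X l ω) j n}) := by
      ext ω
      simp only [HasOscCount, Set.mem_ofPred_eq, Set.mem_iUnion, Set.mem_inter_iff, exists_prop]
    rw [this]
    refine MeasurableSet.iUnion fun j => MeasurableSet.iUnion fun hj => ?_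
    exact MeasurableSet.inter (blockAlgebra_mono X (Set.Iio_subset_Iio hj) _ (ih j))
      (blockAlgebra_mono X (fun l hl => hl.2) _ (measurableSet_hasOsc hX t j n))

end Blocks

/-! ### Maximal inequalities for independent summands -/

section RealLemmas

/-- The convex function `y ^ (k + 1)` lies above its tangent at `a`. -/
lemma pow_succ_add_mul_le {a b : ℝ} (ha : 0 ≤ a) (hab : a ≤ b) (k : ℕ) :
    a ^ (k + 1) + (k + 1) * (b - a) * a ^ k ≤ b ^ (k + 1) := by
  induction k with
  | zero => simp
  | succ k ih =>
    have h1 : a ^ (k + 1) ≤ b ^ (k + 1) := pow_le_pow_left₀ ha hab _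
    have h2 : (b - a) * a ^ (k + 1) ≤ (b - a) * b ^ (k + 1) :=
      mul_le_mul_of_nonneg_left h1 (by linarith)
    have h3 := mul_le_mul_of_nonneg_left ih ha
    have e1 : a * (a ^ (k + 1) + (k + 1) * (b - a) * a ^ k) =
      a ^ (k + 1 + 1) + (k + 1) * ((b - a) * a ^ (k + 1)) := by ring
    have e2 : b ^ (k + 1 + 1) = a * b ^ (k + 1) + (b - a) * b ^ (k + 1) := by ring
    have e3 : a ^ (k + 1 + 1) + (((k + 1 : ℕ) : ℝ) + 1) * (b - a) * a ^ (k + 1) =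
      a ^ (k + 1 + 1) + (k + 1) * ((b - a) * a ^ (k + 1)) + (b - a) * a ^ (k + 1) := by
      push_cast; ring
    rw [e3, e2]
    linarith

/-- Discrete form of `∫ H ^ k / k! dH = H ^ (k + 1) / (k + 1)!`: summation by parts turns the left
side into cumulated masses times increments of `H`. It is the induction step for the Poisson tails.
-/
lemma sum_mul_sub_le {d H : ℕ → ℝ} (hH : Monotone H) (h0 : 0 ≤ H 0) (k : ℕ)
    (hd : ∀ n, ∑ j ∈ Finset.range (n + 1), d j ≤ H n ^ k / k.factorial) (n : ℕ) :
    ∑ j ∈ Finset.range (n + 1), d j * (H n - H j) ≤ H n ^ (k + 1) / (k + 1).factorial := by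
  have hnn : ∀ n, 0 ≤ H n := fun n => h0.trans (hH (Nat.zero_le n))
  induction n with
  | zero =>
    simp only [zero_add, Finset.sum_range_one, sub_self, mul_zero]
    exact div_nonneg (pow_nonneg h0 _) (by positivity)
  | succ n ih =>
    rw [Finset.sum_range_succ, sub_self, mul_zero, add_zero]
    have e : ∑ j ∈ Finset.range (n + 1), d j * (H (n + 1) - H j) =
        ∑ j ∈ Finset.range (n + 1), d j * (H n - H j) +
          (∑ j ∈ Finset.range (n + 1), d j) * (H (n + 1) - H n) := by
      rw [Finset.sum_mul, ← Finset.sum_add_distrib]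
      exact Finset.sum_congr rfl fun j _ => by ring
    have h1 := hH n.le_succ
    have h2 := mul_le_mul_of_nonneg_right (hd n) (sub_nonneg.2 h1)
    have h3 := pow_succ_add_mul_le (hnn n) h1 k
    have hf : (0 : ℝ) < ((k + 1).factorial : ℝ) := by positivity
    have hk : ((k + 1).factorial : ℝ) = (k + 1) * k.factorial := by
      rw [Nat.factorial_succ]; push_cast; ring
    have e2 : H n ^ k / k.factorial * (H (n + 1) - H n) =
        (k + 1) * (H (n + 1) - H n) * H n ^ k / (k + 1).factorial := by
      rw [hk]; field_simp
    rw [e]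
    calc _ ≤ H n ^ (k + 1) / (k + 1).factorial +
          (k + 1) * (H (n + 1) - H n) * H n ^ k / (k + 1).factorial := by
            rw [← e2]; exact add_le_add ih h2
      _ ≤ _ := by rw [← add_div]; gcongr

end RealLemmas

section Maximal

variable {Ω F : Type*} [MeasurableSpace Ω] {μ : Measure Ω} [IsProbabilityMeasure μ]
  [NormedAddCommGroup F] [MeasurableSpace F] [BorelSpace F] {X : ℕ → Ω → F}

lemma sum_measureReal_disjointed {A : ℕ → Set Ω} (hA : ∀ j, MeasurableSet (A j))
    (hmono : Monotone A) (n : ℕ) :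
    ∑ j ∈ Finset.range (n + 1), μ.real (disjointed A j) = μ.real (A n) := by
  rw [← measureReal_biUnion_finset]
  · congr 1
    have h := partialSups_disjointed A
    have h2 := congrArg (fun f => f n) h
    simp only [hmono.partialSups_eq] at h2
    rw [← h2, partialSups_eq_biUnion_range]
  · exact fun i _ j _ hij => disjoint_disjointed A hij
  · exact fun j _ => MeasurableSet.disjointed hA j

/-- The number of disjoint oscillations has Poisson tails. -/
lemma measureReal_hasOscCount_le (hX : ∀ i, StronglyMeasurable (X i)) (hindep : iIndepFun X μ)
    {t : ℝ} (hosc : ∀ n, μ.real {ω | HasOsc t (fun l => X l ω) 0 n} ≤ 1 / 2) (k n : ℕ) :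
    μ.real {ω | HasOscCount t (fun l => X l ω) k n} ≤ 1 / k.factorial := by
  have hXm : ∀ i, Measurable (X i) := fun i => (hX i).measurable
  set B : ℕ → ℕ → Set Ω := fun i j => {ω | HasOsc t (fun l => X l ω) i j} with hB
  have hBb : ∀ i j, MeasurableSet[blockAlgebra X (Set.Ico i j)] (B i j) := measurableSet_hasOsc hX t
  have hBm : ∀ i j, MeasurableSet (B i j) := fun i j => blockAlgebra_le hXm _ _ (hBb i j)
  set q : ℕ → ℝ := fun n => μ.real (B 0 n)ᶜ with hq
  have hqB : ∀ n, q n = 1 - μ.real (B 0 n) := fun n => probReal_compl_eq_one_sub (hBm 0 n)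
  have hq2 : ∀ n, 1 / 2 ≤ q n := fun n => by rw [hqB]; linarith [hosc n]
  have hq1 : ∀ n, q n ≤ 1 := fun n => by rw [hqB]; linarith [measureReal_nonneg (μ := μ) (s := B 0 n)]
  have hqpos : ∀ n, 0 < q n := fun n => by linarith [hq2 n]
  -- `H` is the cumulative hazard of the first oscillation, and plays the role of the Poisson
  -- parameter; `q ≥ 1 / 2` keeps it at most 1.
  set H : ℕ → ℝ := fun n => -Real.log (q n) with hH
  have hqanti : Antitone q := fun m n hmn => measureReal_mono
    (Set.compl_subset_compl.2 fun ω h => HasOsc.mono h le_rfl hmn)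
  have hHmono : Monotone H := fun m n hmn =>
    neg_le_neg (Real.log_le_log (hqpos n) (hqanti hmn))
  have hHnn : ∀ n, 0 ≤ H n := fun n =>
    neg_nonneg.2 (Real.log_nonpos (hqpos n).le (hq1 n))
  have hH1 : ∀ n, H n ≤ 1 := fun n => by
    have := Real.one_sub_inv_le_log_of_pos (hqpos n)
    have h2 : (q n)⁻¹ ≤ 2 := by
      rw [inv_le_comm₀ (hqpos n) (by norm_num)]; linarith [hq2 n]
    simp only [hH]; linarith
  -- No oscillation in `[0, n)` means none in `[0, j)` and none in `[j, n)`, which are independent.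
  -- Hence `q n / q j ≤ 1 - μ.real (B j n)`, and `1 - 1 / y ≤ log y` converts this into an increment
  -- of `H`.
  have hBH : ∀ j n, j ≤ n → μ.real (B j n) ≤ H n - H j := by
    intro j n hjn
    have h1 : q n ≤ q j * μ.real (B j n)ᶜ := by
      rw [hq, ← measureReal_inter_block hXm hindep (j := j)]
      · exact measureReal_mono fun ω h =>
          ⟨fun h' => h (HasOsc.mono h' le_rfl hjn), fun h' => h (HasOsc.mono h' (Nat.zero_le j) le_rfl)⟩
      · exact (blockAlgebra_mono X (fun l hl => hl.2) _ (hBb 0 j)).compl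
      · exact (blockAlgebra_mono X (fun l hl => hl.1) _ (hBb j n)).compl
    rw [probReal_compl_eq_one_sub (hBm j n)] at h1
    have h2 := Real.one_sub_inv_le_log_of_pos (div_pos (hqpos j) (hqpos n))
    rw [Real.log_div (hqpos j).ne' (hqpos n).ne', inv_div] at h2
    have h3 : q n / q j ≤ 1 - μ.real (B j n) := by
      rw [div_le_iff₀ (hqpos j)]; linarith
    simp only [hH]; linarith
  have main : ∀ k n, μ.real {ω | HasOscCount t (fun l => X l ω) k n} ≤ H n ^ k / k.factorial := by
    intro k
    induction k with
    | zero => intro n; simp [HasOscCount]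
    | succ k ih =>
      intro n
      set A : ℕ → Set Ω := fun j => {ω | HasOscCount t (fun l => X l ω) k j} with hA
      have hAb := measurableSet_hasOscCount (X := X) hX t k
      have hAm : ∀ j, MeasurableSet (A j) := fun j => blockAlgebra_le hXm _ _ (hAb j)
      have hAmono : Monotone A := fun i j hij ω h => HasOscCount.mono h hij
      -- Decompose by the first time `i` at which `k` oscillations are complete; the last
      -- oscillation then lies in `[i, n)`, independent of that event.
      have hsub : {ω | HasOscCount t (fun l => X l ω) (k + 1) n} ⊆
          ⋃ j ∈ Finset.range (n + 1), (disjointed A j ∩ B j n) := by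
        rintro ω ⟨j, hj, h1, h2⟩
        have h3 : ω ∈ ⋃ i ∈ Finset.range (j + 1), disjointed A i := by
          have h := congrArg (fun f => f j) (partialSups_disjointed A)
          simp only [hAmono.partialSups_eq] at h
          rw [partialSups_eq_biUnion_range] at h
          rw [h]; exact h1
        simp only [Set.mem_iUnion, Finset.mem_range, exists_prop] at h3 ⊢
        obtain ⟨i, hi, h4⟩ := h3
        exact ⟨i, by omega, h4, HasOsc.mono h2 (by omega) le_rfl⟩
      calc _ ≤ μ.real (⋃ j ∈ Finset.range (n + 1), (disjointed A j ∩ B j n)) :=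
            measureReal_mono hsub (measure_ne_top μ _)
        _ ≤ ∑ j ∈ Finset.range (n + 1), μ.real (disjointed A j ∩ B j n) :=
            measureReal_biUnion_finset_le _ _
        _ = ∑ j ∈ Finset.range (n + 1), μ.real (disjointed A j) * μ.real (B j n) := by
            refine Finset.sum_congr rfl fun j _ => measureReal_inter_block hXm hindep
              (measurableSet_disjointed_block hAb j)
              (blockAlgebra_mono X (fun l hl => hl.1) _ (hBb j n))
        _ ≤ ∑ j ∈ Finset.range (n + 1), μ.real (disjointed A j) * (H n - H j) := by
            refine Finset.sum_le_sum fun j hj => mul_le_mul_of_nonneg_left (hBH j n ?_)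
              measureReal_nonneg
            rw [Finset.mem_range] at hj; omega
        _ ≤ _ := sum_mul_sub_le hHmono (hHnn 0) k
            (fun m => by rw [sum_measureReal_disjointed hAm hAmono]; exact ih m) n
  refine (main k n).trans ?_
  gcongr
  exact pow_le_one₀ (hHnn n) (hH1 n)

/-- A version of Ottaviani's maximal inequality. -/
lemma ottaviani (hX : ∀ i, StronglyMeasurable (X i)) (hindep : iIndepFun X μ) {r : ℝ≥0} {n : ℕ}
    (hr : ∀ k ≤ n, μ.real {ω | (r : ℝ) < ‖∑ i ∈ Finset.Ico k n, X i ω‖} ≤ 1 / 2)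
    {U : Set ℝ≥0} (hU : IsUpperSet U) :
    μ.real {ω | ∃ k ≤ n, ‖∑ i ∈ Finset.range k, X i ω‖₊ - r ∈ U} ≤
      2 * μ.real {ω | ‖∑ i ∈ Finset.range n, X i ω‖₊ ∈ U} := by
  have hXm : ∀ i, Measurable (X i) := fun i => (hX i).measurable
  have hUm : MeasurableSet U := hU.ordConnected.measurableSet
  set A : ℕ → Set Ω := fun k => {ω | ‖∑ i ∈ Finset.range k, X i ω‖₊ - r ∈ U} with hA
  have hAb : ∀ j, MeasurableSet[blockAlgebra X (Set.Iio j)] (A j) := fun j =>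
    ((stronglyMeasurable_blockAlgebra_sum (s := Set.Iio j) hX (Finset.range j)
      (fun l hl => Finset.mem_range.1 hl)).nnnorm.measurable.sub_const r) hUm
  set B : ℕ → Set Ω := fun k => {ω | (r : ℝ) < ‖∑ i ∈ Finset.Ico k n, X i ω‖} with hB
  have hBb : ∀ j, MeasurableSet[blockAlgebra X (Set.Ici j)] (B j) := fun j =>
    ((stronglyMeasurable_blockAlgebra_sum (s := Set.Ici j) hX (Finset.Ico j n)
      (fun l hl => (Finset.mem_Ico.1 hl).1)).norm.measurable) measurableSet_Ioi
  have hAd := fun j => measurableSet_disjointed_block hAb j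
  have hAdm : ∀ j, MeasurableSet (disjointed A j) := fun j => blockAlgebra_le hXm _ _ (hAd j)
  have hBm : ∀ j, MeasurableSet (B j) := fun j => blockAlgebra_le hXm _ _ (hBb j)
  -- `disjointed A j` is the event of first passage at time `j`. It depends only on the terms before
  -- `j`, so the block from `j` on is independent of it and stays within `r` with probability at
  -- least 1/2.
  have h1 : ∀ j ∈ Finset.range (n + 1),
      μ.real (disjointed A j) ≤ 2 * μ.real (disjointed A j ∩ (B j)ᶜ) := by
    intro j hj
    rw [measureReal_inter_block hXm hindep (hAd j) (hBb j).compl, probReal_compl_eq_one_sub (hBm j)]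
    have h2 := hr j (by rw [Finset.mem_range] at hj; omega)
    have h3 : (0 : ℝ) ≤ μ.real (disjointed A j) := measureReal_nonneg
    have h4 : μ.real (disjointed A j) * (1 / 2) ≤ μ.real (disjointed A j) * (1 - μ.real (B j)) :=
      mul_le_mul_of_nonneg_left (by linarith) h3
    linarith
  have hsub : {ω | ∃ k ≤ n, ‖∑ i ∈ Finset.range k, X i ω‖₊ - r ∈ U} =
      ⋃ j ∈ Finset.range (n + 1), disjointed A j := by
    rw [← partialSups_eq_biUnion_range, partialSups_disjointed, partialSups_eq_biUnion_range]
    ext ω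
    simp only [Set.mem_iUnion, Finset.mem_range, Nat.lt_succ_iff, exists_prop, Set.mem_ofPred_eq, hA]
  have hsub2 : ⋃ j ∈ Finset.range (n + 1), (disjointed A j ∩ (B j)ᶜ) ⊆
      {ω | ‖∑ i ∈ Finset.range n, X i ω‖₊ ∈ U} := by
    intro ω hω
    simp only [Set.mem_iUnion, Finset.mem_range, exists_prop] at hω
    obtain ⟨j, hj, h2, h3⟩ := hω
    have h4 : ‖∑ i ∈ Finset.range j, X i ω‖₊ - r ∈ U := disjointed_subset A j h2
    refine hU ?_ h4
    rw [tsub_le_iff_right, ← NNReal.coe_le_coe]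
    push_cast
    have h5 : ‖∑ i ∈ Finset.Ico j n, X i ω‖ ≤ r := not_lt.1 h3
    rw [Finset.sum_Ico_eq_sub _ (by omega : j ≤ n)] at h5
    have h6 := norm_sub_norm_le (∑ i ∈ Finset.range j, X i ω) (∑ i ∈ Finset.range n, X i ω)
    rw [norm_sub_rev] at h6
    linarith
  rw [hsub]
  calc _ ≤ ∑ j ∈ Finset.range (n + 1), μ.real (disjointed A j) := measureReal_biUnion_finset_le _ _
    _ ≤ ∑ j ∈ Finset.range (n + 1), 2 * μ.real (disjointed A j ∩ (B j)ᶜ) := Finset.sum_le_sum h1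
    _ = 2 * μ.real (⋃ j ∈ Finset.range (n + 1), (disjointed A j ∩ (B j)ᶜ)) := by
        rw [← Finset.mul_sum, measureReal_biUnion_finset]
        · exact fun i _ j _ hij => (disjoint_disjointed A hij).mono Set.inter_subset_left
            Set.inter_subset_left
        · exact fun j _ => (hAdm j).inter (hBm j).compl
    _ ≤ _ := by
        have := measureReal_mono hsub2 (measure_ne_top μ _)
        linarith

end Maximal

/-! ### Orlicz functions -/

section Orlicz

variable {Ψ : ℝ≥0 → ℝ≥0}

lemma IsOrliczFunction.map_div_le (hΨ : IsOrliczFunction Ψ) (x : ℝ≥0) {m : ℝ≥0} (hm : 1 ≤ m) :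
    Ψ (x / m) ≤ Ψ x / m := by
  have hm0 : m ≠ 0 := (zero_lt_one.trans_le hm).ne'
  have h := hΨ.convex.2 (Set.mem_univ x) (Set.mem_univ 0) (zero_le (a := m⁻¹))
    (zero_le (a := 1 - m⁻¹)) (add_tsub_cancel_of_le (inv_le_one_of_one_le₀ hm))
  simp only [smul_eq_mul, mul_zero, add_zero, hΨ.map_zero] at h
  rwa [div_eq_inv_mul, div_eq_inv_mul]

lemma IsOrliczFunction.map_half_add_le (hΨ : IsOrliczFunction Ψ) (x y : ℝ≥0) :
    Ψ ((x + y) / 2) ≤ Ψ x + Ψ y := by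
  rcases le_total x y with h | h
  · have : (x + y) / 2 ≤ y := by
      rw [div_le_iff₀ (by norm_num), mul_two]; gcongr
    exact (hΨ.strictMono.monotone this).trans le_add_self
  · have : (x + y) / 2 ≤ x := by
      rw [div_le_iff₀ (by norm_num), mul_two]; gcongr
    exact (hΨ.strictMono.monotone this).trans le_self_add

lemma orliczExponent_nonneg (Ψ : ℝ≥0 → ℝ≥0) (x : ℝ≥0) : 0 ≤ orliczExponent Ψ x :=
  Real.log_nonneg (by linarith [(Ψ x).coe_nonneg])

lemma exp_orliczExponent (Ψ : ℝ≥0 → ℝ≥0) (x : ℝ≥0) :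
    Real.exp (orliczExponent Ψ x) = 1 + Ψ x :=
  Real.exp_log (by linarith [(Ψ x).coe_nonneg])

lemma IsOrliczFunction.orliczExponent_mono (hΨ : IsOrliczFunction Ψ) :
    Monotone (orliczExponent Ψ) := fun x y h =>
  Real.log_le_log (by linarith [(Ψ x).coe_nonneg])
    (by have := hΨ.strictMono.monotone h; gcongr)

/-- The growth rate `exp (m/2 · log (1 + 2 m))`, which is of smaller order than `m !`. -/
noncomputable def subfactorial (m : ℕ) : ℝ :=
  Real.exp (m * Real.log (1 + 2 * m) / 2)

lemma subfactorial_pos (m : ℕ) : 0 < subfactorial m := Real.exp_pos _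

lemma subfactorial_mono : Monotone subfactorial := by
  intro m n h
  have h' : (m : ℝ) ≤ n := Nat.cast_le.2 h
  have hm : (0 : ℝ) ≤ m := Nat.cast_nonneg m
  have : Real.log (1 + 2 * m) ≤ Real.log (1 + 2 * n) := Real.log_le_log (by linarith) (by linarith)
  have h0 : 0 ≤ Real.log (1 + 2 * (m : ℝ)) := Real.log_nonneg (by linarith)
  unfold subfactorial
  gcongr

lemma subfactorial_sq (m : ℕ) : subfactorial m ^ 2 = (1 + 2 * m) ^ m := by
  have hm : (0 : ℝ) < 1 + 2 * m := by positivity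
  rw [subfactorial, ← Real.exp_nat_mul]
  rw [show ((2 : ℕ) : ℝ) * (m * Real.log (1 + 2 * m) / 2) = m * Real.log (1 + 2 * m) by
    push_cast; ring, Real.exp_nat_mul, Real.exp_log hm]

/-- The square of the growth rate is `(2m + 3) ^ (m + 1)`, at most `(m + 1)! * exp (2m + 3)`, so the
square of the general term still decays like `1 / m!` up to a geometric factor. Square roots are
avoided through `p ≤ c + p ^ 2 / c` with `c = 2 ^ (-m)`. -/
lemma summable_subfactorial_div_factorial :
    Summable fun m : ℕ => subfactorial (m + 1) * (1 / m.factorial) := by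
  have hs : Summable fun m : ℕ => (1 / 2 : ℝ) ^ m +
      Real.exp 3 * ((4 * Real.exp 2) ^ m / m.factorial) :=
    (summable_geometric_of_lt_one (by norm_num) (by norm_num)).add
      ((Real.summable_pow_div_factorial _).mul_left _)
  refine Summable.of_nonneg_of_le (fun m => mul_nonneg (subfactorial_pos _).le (by positivity))
    (fun m => ?_) hs
  have hf : (0 : ℝ) < m.factorial := by positivity
  have h1 : subfactorial (m + 1) ^ 2 ≤ (m + 1) * m.factorial * (Real.exp 3 * Real.exp 2 ^ m) := by
    rw [subfactorial_sq]
    have h := Real.pow_div_factorial_le_exp (1 + 2 * ((m + 1 : ℕ) : ℝ)) (by positivity) (m + 1)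
    rw [div_le_iff₀ (by positivity), Nat.factorial_succ] at h
    refine h.trans (le_of_eq ?_)
    rw [← Real.exp_nat_mul, ← Real.exp_add]
    push_cast
    rw [show (1 : ℝ) + 2 * (m + 1) = 3 + m * 2 by ring]
    ring
  have h2 : (m + 1 : ℝ) ≤ 2 ^ m := by
    exact_mod_cast (Nat.lt_two_pow_self (n := m))
  set p := subfactorial (m + 1) * (1 / m.factorial) with hp
  have hp2 : p ^ 2 * 2 ^ m ≤ Real.exp 3 * ((4 * Real.exp 2) ^ m / m.factorial) := by
    rw [hp, mul_pow]
    calc subfactorial (m + 1) ^ 2 * (1 / (m.factorial : ℝ)) ^ 2 * 2 ^ m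
        ≤ (2 ^ m * m.factorial * (Real.exp 3 * Real.exp 2 ^ m)) *
            (1 / (m.factorial : ℝ)) ^ 2 * 2 ^ m := by
          gcongr
          exact h1.trans (by gcongr)
      _ = _ := by
          rw [mul_pow, show (4 : ℝ) ^ m = 2 ^ m * 2 ^ m by rw [← mul_pow]; norm_num]
          field_simp
  have h3 : (1 / 2 : ℝ) ^ m * 2 ^ m = 1 := by rw [← mul_pow]; norm_num
  set c : ℝ := (1 / 2 : ℝ) ^ m with hc
  have hc0 : 0 < c := by positivity
  have hd0 : (0 : ℝ) < 2 ^ m := by positivity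
  have h4 : p ≤ c + p ^ 2 * 2 ^ m := by
    generalize (2 : ℝ) ^ m = d at *
    nlinarith [sq_nonneg (c - p), mul_nonneg hd0.le (sq_nonneg (c - p))]
  linarith

/-- The dichotomy obtained by averaging (HJ) over the summands. -/
lemma IsOrliczFunction.orliczExponent_sum_le (hΨ : IsOrliczFunction Ψ) {K : ℝ≥0} (hK : 1 ≤ K)
    (hHJ : ∀ s u : ℝ≥0, K ≤ s → K ≤ u → orliczExponent Ψ (s * u) ≤
      K * ((s : ℝ) * Real.log (1 + (s : ℝ)) + (s : ℝ) * orliczExponent Ψ u))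
    {ι : Type*} (I : Finset ι) (y : ι → ℝ≥0) (hy : ∀ i ∈ I, K ≤ y i)
    (hlarge : ∀ i ∈ I, y i < (∑ j ∈ I, y j) / (8 * K ^ 2)) :
    orliczExponent Ψ ((∑ j ∈ I, y j) / (8 * K)) ≤
      (I.card * Real.log (1 + 2 * I.card) + ∑ i ∈ I, orliczExponent Ψ (y i)) / 4 := by
  classical
  rcases I.eq_empty_or_nonempty with rfl | hne
  · simp [orliczExponent, hΨ.map_zero]
  have hK0 : (0 : ℝ≥0) < K := zero_lt_one.trans_le hK
  have hyp : ∀ i ∈ I, 0 < y i := fun i hi => hK0.trans_le (hy i hi)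
  set T := ∑ j ∈ I, y j with hT
  have hTpos : 0 < T := Finset.sum_pos hyp hne
  have hTr : (T : ℝ) = ∑ j ∈ I, (y j : ℝ) := by rw [hT]; push_cast; rfl
  set L := orliczExponent Ψ (T / (8 * K)) with hL
  have hL0 : 0 ≤ L := orliczExponent_nonneg _ _
  set k : ℝ := (I.card : ℝ) with hk
  have hk1 : 1 ≤ k := by rw [hk]; exact_mod_cast hne.card_pos
  have hlog : 0 ≤ Real.log (1 + 2 * k) := Real.log_nonneg (by linarith)
  -- Keep the terms that are at least half the average. They carry at least half of `T`, and for
  -- them the ratio `s` below is at most `2 * k`, so the logarithm in (HJ) is uniform.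
  set G := I.filter fun i => (T : ℝ) ≤ 2 * k * y i with hG
  have hstep : ∀ i ∈ G, (y i : ℝ) * L ≤
      T / 8 * (Real.log (1 + 2 * k) + orliczExponent Ψ (y i)) := by
    intro i hi
    obtain ⟨hiI, hiT⟩ := Finset.mem_filter.1 hi
    have hyi := hyp i hiI
    -- With this `s`, the product `s * y i` does not depend on `i`, `hlarge` gives `K ≤ s`, and
    -- multiplying (HJ) by the weight `y i` makes the coefficient the constant `T / 8`.
    set s : ℝ≥0 := T / (8 * K * y i) with hs
    have hsy : s * y i = T / (8 * K) := by rw [hs]; field_simp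
    have hsK : K ≤ s := by
      rw [hs, le_div_iff₀ (by positivity)]
      have := (hlarge i hiI).le
      rw [le_div_iff₀ (by positivity)] at this
      calc K * (8 * K * y i) = y i * (8 * K ^ 2) := by ring
        _ ≤ T := this
    have h := hHJ s (y i) hsK (hy i hiI)
    rw [hsy, ← hL] at h
    have hs2 : (s : ℝ) ≤ 2 * k := by
      rw [hs]; push_cast
      have hKr : (1 : ℝ) ≤ K := by exact_mod_cast hK
      have hyr : (0 : ℝ) < y i := by exact_mod_cast hyi
      rw [div_le_iff₀ (by positivity)]
      have : 2 * k * (y i : ℝ) * 1 ≤ 2 * k * y i * (8 * K) := by gcongr; linarith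
      calc (T : ℝ) ≤ 2 * k * y i * 1 := by linarith
        _ ≤ _ := this
        _ = _ := by ring
    have hlog2 : Real.log (1 + s) ≤ Real.log (1 + 2 * k) :=
      Real.log_le_log (by linarith [s.coe_nonneg]) (by linarith)
    have hys : (y i : ℝ) * (K * s) = T / 8 := by
      have : (y i : ℝ) ≠ 0 := by exact_mod_cast hyi.ne'
      have : (K : ℝ) ≠ 0 := by exact_mod_cast hK0.ne'
      rw [hs]; push_cast; field_simp
    calc (y i : ℝ) * L ≤ y i * (K * (s * Real.log (1 + s) + s * orliczExponent Ψ (y i))) := by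
          gcongr
      _ = y i * (K * s) * (Real.log (1 + s) + orliczExponent Ψ (y i)) := by ring
      _ ≤ y i * (K * s) * (Real.log (1 + 2 * k) + orliczExponent Ψ (y i)) := by gcongr
      _ = _ := by rw [hys]
  have hGsum : (T : ℝ) / 2 ≤ ∑ i ∈ G, (y i : ℝ) := by
    have hsplit := Finset.sum_filter_add_sum_filter_not I
      (fun i => (T : ℝ) ≤ 2 * k * y i) (fun i => (y i : ℝ))
    have hsmall : ∑ i ∈ I.filter (fun i => ¬ (T : ℝ) ≤ 2 * k * y i), (y i : ℝ) ≤ T / 2 := by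
      calc _ ≤ ∑ i ∈ I.filter (fun i => ¬ (T : ℝ) ≤ 2 * k * y i), (T : ℝ) / (2 * k) := by
            refine Finset.sum_le_sum fun i hi => ?_
            have := (Finset.mem_filter.1 hi).2
            rw [le_div_iff₀ (by linarith)]; linarith
        _ ≤ ∑ i ∈ I, (T : ℝ) / (2 * k) :=
            Finset.sum_le_sum_of_subset_of_nonneg (Finset.filter_subset _ _)
              fun _ _ _ => by positivity
        _ = T / 2 := by
            rw [Finset.sum_const, nsmul_eq_mul, ← hk]; field_simp
    rw [← hTr] at hsplit
    linarith
  have hmain : (T : ℝ) / 2 * L ≤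
      T / 8 * (k * Real.log (1 + 2 * k) + ∑ i ∈ I, orliczExponent Ψ (y i)) := by
    calc (T : ℝ) / 2 * L ≤ (∑ i ∈ G, (y i : ℝ)) * L := by gcongr
      _ = ∑ i ∈ G, (y i : ℝ) * L := Finset.sum_mul _ _ _
      _ ≤ ∑ i ∈ G, T / 8 * (Real.log (1 + 2 * k) + orliczExponent Ψ (y i)) :=
          Finset.sum_le_sum hstep
      _ ≤ ∑ i ∈ I, T / 8 * (Real.log (1 + 2 * k) + orliczExponent Ψ (y i)) :=
          Finset.sum_le_sum_of_subset_of_nonneg (Finset.filter_subset _ _) fun i _ _ =>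
            mul_nonneg (by positivity) (add_nonneg hlog (orliczExponent_nonneg _ _))
      _ = _ := by
          rw [← Finset.mul_sum, Finset.sum_add_distrib, Finset.sum_const, nsmul_eq_mul]
  have hTr0 : (0 : ℝ) < T := by exact_mod_cast hTpos
  have h8 : T / 8 * (4 * L) ≤
      T / 8 * (k * Real.log (1 + 2 * k) + ∑ i ∈ I, orliczExponent Ψ (y i)) := by
    calc _ = (T : ℝ) / 2 * L := by ring
      _ ≤ _ := hmain
  have := le_of_mul_le_mul_left h8 (by positivity)
  linarith

/-- If no single term dominates the scaled sum, exponentiating the averaged bound gives a product `a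
* b`. The factor 1/4 in the exponent leaves room for `a * b ≤ a ^ 2 + b ^ 2`, which separates the
count of terms from their sizes; these two quantities are not independent. -/
lemma IsOrliczFunction.map_sum_le (hΨ : IsOrliczFunction Ψ) {K : ℝ≥0} (hK : 1 ≤ K)
    (hHJ : ∀ s u : ℝ≥0, K ≤ s → K ≤ u → orliczExponent Ψ (s * u) ≤
      K * ((s : ℝ) * Real.log (1 + (s : ℝ)) + (s : ℝ) * orliczExponent Ψ u))
    {ι : Type*} (I : Finset ι) (y : ι → ℝ≥0) (hy : ∀ i ∈ I, K ≤ y i) :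
    (Ψ ((∑ j ∈ I, y j) / (8 * K ^ 2)) : ℝ) ≤
      Ψ (I.sup y) + subfactorial I.card + ∏ i ∈ I, (1 + (Ψ (y i) : ℝ)) := by
  have hprod : 0 ≤ ∏ i ∈ I, (1 + (Ψ (y i) : ℝ)) :=
    Finset.prod_nonneg fun i _ => by positivity
  by_cases h : ∃ i ∈ I, (∑ j ∈ I, y j) / (8 * K ^ 2) ≤ y i
  · obtain ⟨i, hi, h⟩ := h
    have h1 : Ψ ((∑ j ∈ I, y j) / (8 * K ^ 2)) ≤ Ψ (I.sup y) :=
      hΨ.strictMono.monotone (h.trans (Finset.le_sup hi))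
    have h2 := subfactorial_pos I.card
    have h1' : (Ψ ((∑ j ∈ I, y j) / (8 * K ^ 2)) : ℝ) ≤ Ψ (I.sup y) := by exact_mod_cast h1
    linarith
  · push Not at h
    have h1 := hΨ.orliczExponent_sum_le hK hHJ I y hy h
    have hle : (∑ j ∈ I, y j) / (8 * K ^ 2) ≤ (∑ j ∈ I, y j) / (8 * K) := by
      have : K ≤ K ^ 2 := le_self_pow₀ hK (by norm_num)
      have : 0 < K := zero_lt_one.trans_le hK
      gcongr
    have h2 := hΨ.orliczExponent_mono hle
    have h3 := Real.exp_le_exp.2 (h2.trans h1)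
    rw [exp_orliczExponent, add_div, Real.exp_add] at h3
    set a := Real.exp (I.card * Real.log (1 + 2 * I.card) / 4) with ha
    set b := Real.exp ((∑ i ∈ I, orliczExponent Ψ (y i)) / 4) with hb
    have ha2 : a ^ 2 = subfactorial I.card := by
      rw [ha, subfactorial, ← Real.exp_nat_mul]; congr 1; push_cast; ring
    have hsum : 0 ≤ ∑ i ∈ I, orliczExponent Ψ (y i) :=
      Finset.sum_nonneg fun i _ => orliczExponent_nonneg _ _
    have hb2 : b ^ 2 ≤ ∏ i ∈ I, (1 + (Ψ (y i) : ℝ)) := by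
      simp_rw [← exp_orliczExponent]
      rw [← Real.exp_sum, hb, ← Real.exp_nat_mul]
      refine Real.exp_le_exp.2 ?_
      push_cast; linarith
    have hΨ0 : (0 : ℝ) ≤ Ψ (I.sup y) := NNReal.coe_nonneg _
    nlinarith [sq_nonneg (a - b), sq_nonneg a, sq_nonneg b]

/-- (HJ) with `u = K` fixed bounds `ψ (s * K)` by a multiple of `s * (log (1 + s) + 1)`; a small
enough step `c` brings the multiple below 1/2. -/
lemma IsOrliczFunction.exists_map_nat_mul_le (hΨ : IsOrliczFunction Ψ) {K : ℝ≥0} (hK : 1 ≤ K)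
    (hHJ : ∀ s u : ℝ≥0, K ≤ s → K ≤ u → orliczExponent Ψ (s * u) ≤
      K * ((s : ℝ) * Real.log (1 + (s : ℝ)) + (s : ℝ) * orliczExponent Ψ u)) :
    ∃ c : ℝ≥0, 0 < c ∧ ∀ R : ℕ, (Ψ (R * c) : ℝ) ≤ Ψ (K ^ 2) + subfactorial R := by
  have hK0 : 0 < K := zero_lt_one.trans_le hK
  set p : ℝ≥0 := ⟨orliczExponent Ψ K, orliczExponent_nonneg _ _⟩ with hp
  have hpr : (p : ℝ) = orliczExponent Ψ K := rfl
  set B : ℝ≥0 := 4 * K * (1 + p) with hB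
  have hB0 : 0 < B := by positivity
  refine ⟨K / B, by positivity, fun R => ?_⟩
  set s : ℝ≥0 := R / B with hs
  have hsK : (R : ℝ≥0) * (K / B) = s * K := by rw [hs]; ring
  rw [hsK]
  rcases le_total s K with h | h
  · have h1 : Ψ (s * K) ≤ Ψ (K ^ 2) := hΨ.strictMono.monotone (by rw [sq]; gcongr)
    have h1' : (Ψ (s * K) : ℝ) ≤ Ψ (K ^ 2) := by exact_mod_cast h1
    linarith [subfactorial_pos R]
  · have h1 := hHJ s K h le_rfl
    have hR : 1 ≤ R := by
      rcases Nat.eq_zero_or_pos R with h0 | h0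
      · rw [hs, h0] at h; simp at h; exact absurd h hK0.ne'
      · exact h0
    have hRr : (1 : ℝ) ≤ R := by exact_mod_cast hR
    have hKs : (K : ℝ) * s * (1 + p) = R / 4 := by
      have h4 : (K : ℝ) ≠ 0 := by exact_mod_cast hK0.ne'
      have h5 : (1 + p : ℝ) ≠ 0 := by positivity
      rw [hs, hB]; push_cast; field_simp
    have hKr : (1 : ℝ) ≤ K := by exact_mod_cast hK
    have hsR : (s : ℝ) ≤ 2 * R := by
      have h6 : (s : ℝ) ≤ K * s * (1 + p) := by
        have : (1 : ℝ) ≤ K * (1 + p) := by nlinarith [p.coe_nonneg]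
        nlinarith [s.coe_nonneg]
      linarith
    have hlog : Real.log (1 + s) ≤ Real.log (1 + 2 * R) :=
      Real.log_le_log (by linarith [s.coe_nonneg]) (by linarith)
    -- Since `1 + 2 * R ≥ 3 > e`, the constant `p` can be absorbed into `p * log (1 + 2 * R)`.
    have hlog1 : 1 ≤ Real.log (1 + 2 * R) := by
      rw [Real.le_log_iff_exp_le (by linarith)]
      linarith [Real.exp_one_lt_d9]
    have hp0 : (0 : ℝ) ≤ p := p.coe_nonneg
    have hs0 : (0 : ℝ) ≤ K * s := by positivity
    have h2 : orliczExponent Ψ (s * K) ≤ R * Real.log (1 + 2 * R) / 2 := by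
      calc _ ≤ K * ((s : ℝ) * Real.log (1 + (s : ℝ)) + (s : ℝ) * p) := h1
        _ = K * s * (Real.log (1 + s) + p) := by ring
        _ ≤ K * s * (Real.log (1 + 2 * R) + p * Real.log (1 + 2 * R)) := by
            gcongr; nlinarith
        _ = K * s * (1 + p) * Real.log (1 + 2 * R) := by ring
        _ = R / 4 * Real.log (1 + 2 * R) := by rw [hKs]
        _ ≤ _ := by nlinarith
    have h3 := Real.exp_le_exp.2 h2
    rw [exp_orliczExponent] at h3
    have : (0 : ℝ) ≤ Ψ (K ^ 2) := NNReal.coe_nonneg _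
    rw [subfactorial]; linarith

end Orlicz

/-! ### The Orlicz norm -/

section OrliczNorm

variable {Ψ : ℝ≥0 → ℝ≥0}

@[simp]
lemma orliczExtend_coe (Ψ : ℝ≥0 → ℝ≥0) (x : ℝ≥0) : orliczExtend Ψ (x : ℝ≥0∞) = Ψ x := by
  simp [orliczExtend]

lemma orliczExtend_enorm_div {E : Type*} [SeminormedAddGroup E] (Ψ : ℝ≥0 → ℝ≥0) (x : E) {a : ℝ≥0}
    (ha : 0 < a) : orliczExtend Ψ (‖x‖ₑ / a) = Ψ (‖x‖₊ / a) := by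
  rw [enorm_eq_nnnorm, ← ENNReal.coe_div ha.ne', orliczExtend_coe]

lemma IsOrliczFunction.orliczExtend_mono (hΨ : IsOrliczFunction Ψ) : Monotone (orliczExtend Ψ) := by
  intro x y h
  induction y with
  | top => simp [orliczExtend]
  | coe y =>
    lift x to ℝ≥0 using ne_top_of_le_ne_top ENNReal.coe_ne_top h
    simpa using hΨ.strictMono.monotone (ENNReal.coe_le_coe.1 h)

lemma IsOrliczFunction.orliczExtend_div_le (hΨ : IsOrliczFunction Ψ) (x : ℝ≥0∞) {m : ℝ≥0}
    (hm : 1 ≤ m) : orliczExtend Ψ (x / m) ≤ orliczExtend Ψ x / m := by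
  have hm0 : m ≠ 0 := (zero_lt_one.trans_le hm).ne'
  induction x with
  | top => simp [orliczExtend, ENNReal.top_div_of_ne_top]
  | coe x =>
    rw [← ENNReal.coe_div hm0, orliczExtend_coe, orliczExtend_coe, ← ENNReal.coe_div hm0]
    exact_mod_cast hΨ.map_div_le x hm

/-- Convexity forces at least linear growth, so bounded values of `Ψ` come from bounded arguments.
-/
lemma IsOrliczFunction.mul_map_one_le (hΨ : IsOrliczFunction Ψ) (x : ℝ≥0) :
    x * Ψ 1 ≤ Ψ x + Ψ 1 := by
  rcases le_total 1 x with h | h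
  · have h1 := hΨ.map_div_le x h
    have hx : x ≠ 0 := (zero_lt_one.trans_le h).ne'
    rw [div_self hx, le_div_iff₀ (zero_lt_one.trans_le h), mul_comm] at h1
    exact h1.trans le_self_add
  · exact (mul_le_of_le_one_left zero_le h).trans le_add_self

variable {Ω : Type*} [MeasurableSpace Ω] {μ : Measure Ω}

lemma eOrliczNorm_mono {E E' : Type*} [ENorm E] [ENorm E'] (hΨ : IsOrliczFunction Ψ)
    {Y : Ω → E} {Z : Ω → E'} (h : ∀ ω, ‖Y ω‖ₑ ≤ ‖Z ω‖ₑ) :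
    eOrliczNorm Ψ Y μ ≤ eOrliczNorm Ψ Z μ := by
  refine le_iInf fun a => le_iInf fun ha => le_iInf fun hZ => iInf_le_of_le a (iInf_le_of_le ha
    (iInf_le_of_le ((lintegral_mono fun ω => ?_).trans hZ) le_rfl))
  exact hΨ.orliczExtend_mono (ENNReal.div_le_div_right (h ω) _)

lemma lintegral_orliczExtend_le_one {E : Type*} [ENorm E] (hΨ : IsOrliczFunction Ψ)
    {Y : Ω → E} {C : ℝ≥0} (h : eOrliczNorm Ψ Y μ < C) :
    0 < C ∧ ∫⁻ ω, orliczExtend Ψ (‖Y ω‖ₑ / C) ∂μ ≤ 1 := by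
  simp only [eOrliczNorm, iInf_lt_iff] at h
  obtain ⟨a, ha, hY, haC⟩ := h
  have haC' : a ≤ C := (ENNReal.coe_lt_coe.1 haC).le
  refine ⟨ha.trans_le haC', (lintegral_mono fun ω => ?_).trans hY⟩
  exact hΨ.orliczExtend_mono (ENNReal.div_le_div_left (by exact_mod_cast haC') _)

/-- A finite moment suffices, not one bounded by 1: by convexity, enlarging the scale by a factor `m
≥ 1` divides the moment by at least `m`. -/
lemma eOrliczNorm_lt_top {E : Type*} [ENorm E] (hΨ : IsOrliczFunction Ψ)
    {Y : Ω → E} {a : ℝ≥0} (ha : 0 < a)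
    (h : ∫⁻ ω, orliczExtend Ψ (‖Y ω‖ₑ / a) ∂μ < ∞) : eOrliczNorm Ψ Y μ < ∞ := by
  obtain ⟨C, hC⟩ := ENNReal.lt_iff_exists_coe.1 h
  have hm : 1 ≤ max 1 C := le_max_left _ _
  have hm0 : 0 < max 1 C := zero_lt_one.trans_le hm
  refine lt_of_le_of_lt (iInf_le_of_le (a * max 1 C) (iInf_le_of_le (by positivity)
    (iInf_le_of_le ?_ le_rfl))) ENNReal.coe_lt_top
  calc ∫⁻ ω, orliczExtend Ψ (‖Y ω‖ₑ / ((a * max 1 C : ℝ≥0) : ℝ≥0∞)) ∂μ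
      ≤ ∫⁻ ω, orliczExtend Ψ (‖Y ω‖ₑ / a) * ((max 1 C : ℝ≥0) : ℝ≥0∞)⁻¹ ∂μ := by
        refine lintegral_mono fun ω => ?_
        rw [← div_eq_mul_inv]
        refine le_trans (le_of_eq ?_) (hΨ.orliczExtend_div_le _ hm)
        rw [ENNReal.coe_mul, div_eq_mul_inv, div_eq_mul_inv, div_eq_mul_inv, mul_assoc,
          ENNReal.mul_inv (Or.inr ENNReal.coe_ne_top) (Or.inl ENNReal.coe_ne_top)]
    _ = (C : ℝ≥0∞) * ((max 1 C : ℝ≥0) : ℝ≥0∞)⁻¹ := by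
        rw [lintegral_mul_const' _ _ (ENNReal.inv_ne_top.2 (by exact_mod_cast hm0.ne')), hC.1]
    _ ≤ 1 := by
        rw [← div_eq_mul_inv]
        refine ENNReal.div_le_of_le_mul ?_
        rw [one_mul]
        exact_mod_cast le_max_right _ _

/-- The factor 2 replaces continuity of `Ψ`: a finite positive supremum is exceeded by twice some
term. An infinite supremum needs `Ψ` to be unbounded. -/
lemma IsOrliczFunction.orliczExtend_iSup_le (hΨ : IsOrliczFunction Ψ) (m : ℕ → ℝ≥0) {A : ℝ≥0}
    (hA : 0 < A) : orliczExtend Ψ ((⨆ n, (m n : ℝ≥0∞)) / (2 * A : ℝ≥0)) ≤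
      ⨆ n, (Ψ (m n / A) : ℝ≥0∞) := by
  have h2A : (0 : ℝ≥0) < 2 * A := by positivity
  rcases eq_or_ne (⨆ n, (m n : ℝ≥0∞)) ∞ with htop | htop
  · refine le_of_eq_of_le ?_ (le_of_not_gt fun hlt => ?_ : (∞ : ℝ≥0∞) ≤ _)
    · rw [htop, ENNReal.top_div_of_ne_top ENNReal.coe_ne_top, orliczExtend, if_pos rfl]
    · obtain ⟨B, hB⟩ := ENNReal.lt_iff_exists_coe.1 hlt
      have hΨ1 : 0 < Ψ 1 := by
        have := hΨ.strictMono (zero_lt_one' ℝ≥0)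
        rwa [hΨ.map_zero] at this
      have hbound : ∀ n, m n ≤ (B + Ψ 1) / Ψ 1 * A := by
        intro n
        have h1 : (Ψ (m n / A) : ℝ≥0∞) ≤ B := hB.1 ▸ le_iSup (fun n => (Ψ (m n / A) : ℝ≥0∞)) n
        have h2 := hΨ.mul_map_one_le (m n / A)
        rw [← div_le_iff₀ hA, le_div_iff₀ hΨ1]
        exact h2.trans (by gcongr; exact_mod_cast h1)
      have : (⨆ n, (m n : ℝ≥0∞)) ≤ (((B + Ψ 1) / Ψ 1 * A : ℝ≥0) : ℝ≥0∞) :=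
        iSup_le fun n => by exact_mod_cast hbound n
      rw [htop] at this
      exact ENNReal.coe_ne_top (top_le_iff.1 this)
  · obtain ⟨z, hz⟩ : ∃ z : ℝ≥0, (z : ℝ≥0∞) = ⨆ n, (m n : ℝ≥0∞) :=
      ⟨_, ENNReal.coe_toNNReal htop⟩
    rw [← hz, ← ENNReal.coe_div h2A.ne', orliczExtend_coe]
    rcases eq_or_ne z 0 with h0 | h0
    · simp [h0, hΨ.map_zero]
    · have hlt : ((z / 2 : ℝ≥0) : ℝ≥0∞) < ⨆ n, (m n : ℝ≥0∞) := by
        rw [← hz]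
        exact_mod_cast NNReal.half_lt_self h0
      obtain ⟨n, hn⟩ := lt_iSup_iff.1 hlt
      refine le_trans ?_ (le_iSup (fun n => (Ψ (m n / A) : ℝ≥0∞)) n)
      have : z / (2 * A) ≤ m n / A := by
        rw [← div_div]
        have : z / 2 ≤ m n := by exact_mod_cast hn.le
        gcongr
      exact_mod_cast hΨ.strictMono.monotone this

/-- Uniform exponential-type moments of an increasing sequence pass to its supremum. -/
lemma memOrlicz_of_monotone (hΨ : IsOrliczFunction Ψ) {Z : Ω → ℝ≥0∞} {M : ℕ → Ω → ℝ≥0}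
    (hM : ∀ n, Measurable (M n)) (hmono : Monotone M) (hZ : ∀ ω, Z ω = ⨆ n, (M n ω : ℝ≥0∞))
    {A : ℝ≥0} (hA : 0 < A) {C : ℝ≥0∞} (hC : C < ∞)
    (hbound : ∀ n, ∫⁻ ω, Ψ (M n ω / A) ∂μ ≤ C) : MemOrlicz Ψ Z μ := by
  have hZm : Measurable Z := by
    rw [show Z = fun ω => ⨆ n, (M n ω : ℝ≥0∞) from funext hZ]
    exact Measurable.iSup fun n => (hM n).coe_nnreal_ennreal
  refine ⟨hZm.stronglyMeasurable, eOrliczNorm_lt_top hΨ (a := 2 * A) (by positivity) ?_⟩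
  refine lt_of_le_of_lt ?_ hC
  have hΨm : Measurable Ψ := hΨ.strictMono.monotone.measurable
  calc _ ≤ ∫⁻ ω, ⨆ n, (Ψ (M n ω / A) : ℝ≥0∞) ∂μ := by
        refine lintegral_mono fun ω => ?_
        rw [enorm_eq_self, hZ]
        exact hΨ.orliczExtend_iSup_le (fun n => M n ω) hA
    _ = ⨆ n, ∫⁻ ω, (Ψ (M n ω / A) : ℝ≥0∞) ∂μ := by
        refine lintegral_iSup (fun n => (hΨm.comp ((hM n).div_const A)).coe_nnreal_ennreal) ?_
        intro m n hmn ω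
        have h : M m ω ≤ M n ω := hmono hmn ω
        have : Ψ (M m ω / A) ≤ Ψ (M n ω / A) := hΨ.strictMono.monotone (by gcongr)
        exact ENNReal.coe_le_coe.2 this
    _ ≤ C := iSup_le hbound

end OrliczNorm

/-! ### Moments of maxima of partial sums -/

section Pointwise

variable {F : Type*} [NormedAddCommGroup F] {Ψ : ℝ≥0 → ℝ≥0}

/-- The maximum of the norms of the first `n + 1` partial sums (the empty one included). -/
def maxSum (x : ℕ → F) (n : ℕ) : ℝ≥0 :=
  (Finset.range (n + 1)).sup fun k => ‖∑ i ∈ Finset.range k, x i‖₊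

lemma maxSum_mono (x : ℕ → F) : Monotone (maxSum x) := fun _ _ h =>
  Finset.sup_mono (Finset.range_mono (Nat.succ_le_succ h))

lemma exists_maxSum_eq (x : ℕ → F) (n : ℕ) :
    ∃ k ≤ n, maxSum x n = ‖∑ i ∈ Finset.range k, x i‖₊ := by
  obtain ⟨k, hk, h⟩ := Finset.exists_mem_eq_sup (Finset.range (n + 1)) ⟨0, by simp⟩
    fun k => ‖∑ i ∈ Finset.range k, x i‖₊
  exact ⟨k, by rw [Finset.mem_range] at hk; omega, h⟩

lemma norm_le_maxSum (x : ℕ → F) {k n : ℕ} (h : k ≤ n) :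
    ‖∑ i ∈ Finset.range k, x i‖₊ ≤ maxSum x n :=
  Finset.le_sup (f := fun k => ‖∑ i ∈ Finset.range k, x i‖₊) (Finset.mem_range.2 (by omega))

/-- The weight `1 + Ψ (‖v‖ / a)` if `v` has norm larger than `t`, and `0` otherwise. -/
noncomputable def bigWeight (Ψ : ℝ≥0 → ℝ≥0) (a t : ℝ≥0) (v : F) : ℝ≥0∞ :=
  if t < ‖v‖₊ then 1 + (Ψ (‖v‖₊ / a) : ℝ≥0∞) else 0

open Classical in
/-- The function of the number of disjoint oscillations dominating the exponential moments. -/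
noncomputable def oscWeight (t : ℝ) (x : ℕ → F) (n : ℕ) : ℝ≥0∞ :=
  ∑' m : ℕ, if HasOscCount t x m n then ENNReal.ofReal (subfactorial (m + 1)) else 0

lemma subfactorial_le_oscWeight {t : ℝ} {x : ℕ → F} {m n : ℕ} (h : HasOscCount t x m n) :
    ENNReal.ofReal (subfactorial (m + 1)) ≤ oscWeight t x n := by
  refine le_trans ?_ (ENNReal.le_tsum m)
  rw [if_pos h]

/-- The deterministic core: each term on the right has an expectation that is controlled separately.
The condition `K * a ≤ t` puts the rescaled large summands in the range where (HJ) applies. -/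
lemma IsOrliczFunction.map_maxSum_le (hΨ : IsOrliczFunction Ψ) {K : ℝ≥0} (hK : 1 ≤ K)
    (hHJ : ∀ s u : ℝ≥0, K ≤ s → K ≤ u → orliczExponent Ψ (s * u) ≤
      K * ((s : ℝ) * Real.log (1 + (s : ℝ)) + (s : ℝ) * orliczExponent Ψ u))
    {a t : ℝ≥0} (ha : 0 < a) (hat : K * a ≤ t) :
    ∃ A : ℝ≥0, 0 < A ∧ ∀ (x : ℕ → F) (n : ℕ), (Ψ (maxSum x n / A) : ℝ≥0∞) ≤
      Ψ ((Finset.range n).sup (fun i => ‖x i‖₊) / a) + Ψ (K ^ 2) + 2 * oscWeight t x n +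
        ∏ i ∈ Finset.range n, (1 + bigWeight Ψ a t (x i)) := by
  have hK0 : 0 < K := zero_lt_one.trans_le hK
  have ht : 0 < t := (mul_pos hK0 ha).trans_le hat
  obtain ⟨c, hc, hcR⟩ := hΨ.exists_map_nat_mul_le hK hHJ
  set α : ℝ≥0 := 8 * K ^ 2 * a with hα
  set β : ℝ≥0 := 2 * t / c with hβ
  have hα0 : 0 < α := by positivity
  have hβ0 : 0 < β := by positivity
  -- `α` is the scale for the large summands and `β` the one for the excess; the 2 pays for
  -- `map_half_add_le`.
  refine ⟨2 * (α + β), by positivity, fun x n => ?_⟩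
  set I := (Finset.range n).filter fun i => (t : ℝ) < ‖x i‖ with hI
  set T : ℝ≥0 := ∑ i ∈ I, ‖x i‖₊ with hT
  have hTbig : (T : ℝ) = bigSum t x n := by
    rw [hT, bigSum, hI, Finset.sum_filter]; push_cast
    exact Finset.sum_congr rfl fun i _ => by split_ifs <;> simp
  set U : ℝ≥0 := maxSum x n - T with hU
  set R : ℕ := ⌈U / (2 * t)⌉₊ with hR
  have hsum : Ψ (maxSum x n / (2 * (α + β))) ≤ Ψ (T / α) + Ψ (R * c) := by
    refine le_trans (hΨ.strictMono.monotone ?_) (hΨ.map_half_add_le _ _)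
    have h1 : U / β ≤ R * c := by
      have := Nat.le_ceil (U / (2 * t))
      calc U / β = U / (2 * t) * c := by rw [hβ]; field_simp
        _ ≤ R * c := by gcongr
    calc maxSum x n / (2 * (α + β)) ≤ (T + U) / (2 * (α + β)) := by
          gcongr; exact le_add_tsub
      _ = (T / (α + β) + U / (α + β)) / 2 := by field_simp
      _ ≤ (T / α + U / β) / 2 := by
          gcongr
          · exact le_self_add
          · exact le_add_self
      _ ≤ _ := by gcongr
  have hTΨ : (Ψ (T / α) : ℝ≥0∞) ≤ Ψ ((Finset.range n).sup (fun i => ‖x i‖₊) / a) +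
      oscWeight t x n + ∏ i ∈ Finset.range n, (1 + bigWeight Ψ a t (x i)) := by
    have h := hΨ.map_sum_le hK hHJ I (fun i => ‖x i‖₊ / a) fun i hi => by
      rw [le_div_iff₀ ha]
      have : t < ‖x i‖₊ := by exact_mod_cast (Finset.mem_filter.1 hi).2
      exact hat.trans this.le
    have hTα : (∑ j ∈ I, ‖x j‖₊ / a) / (8 * K ^ 2) = T / α := by
      rw [← Finset.sum_div, ← hT, div_div, hα, mul_comm a]
    rw [hTα] at h
    have hsup : I.sup (fun i => ‖x i‖₊ / a) ≤ (Finset.range n).sup (fun i => ‖x i‖₊) / a :=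
      Finset.sup_le fun i hi => by
        have := Finset.le_sup (f := fun i => ‖x i‖₊) (Finset.mem_filter.1 hi).1
        gcongr
    have hosc : ENNReal.ofReal (subfactorial I.card) ≤ oscWeight t x n :=
      (ENNReal.ofReal_le_ofReal (subfactorial_mono (Nat.le_succ _))).trans
        (subfactorial_le_oscWeight (hasOscCount_card n _ le_rfl))
    have hprod : ENNReal.ofReal (∏ i ∈ I, (1 + (Ψ (‖x i‖₊ / a) : ℝ))) ≤
        ∏ i ∈ Finset.range n, (1 + bigWeight Ψ a t (x i)) := by
      rw [ENNReal.ofReal_prod_of_nonneg fun i _ => by positivity, hI, Finset.prod_filter]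
      refine Finset.prod_le_prod' fun i _ => ?_
      split_ifs with h
      · have h' : t < ‖x i‖₊ := by exact_mod_cast h
        rw [bigWeight, if_pos h', ENNReal.ofReal_add zero_le_one (NNReal.coe_nonneg _),
          ENNReal.ofReal_one, ENNReal.ofReal_coe_nnreal]
        exact le_add_self
      · exact le_self_add
    have h' := ENNReal.ofReal_le_ofReal h
    rw [ENNReal.ofReal_coe_nnreal, ENNReal.ofReal_add, ENNReal.ofReal_add,
      ENNReal.ofReal_coe_nnreal] at h'
    · refine h'.trans ?_
      have : (Ψ (I.sup fun i => ‖x i‖₊ / a) : ℝ≥0∞) ≤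
          Ψ ((Finset.range n).sup (fun i => ‖x i‖₊) / a) := by
        exact_mod_cast hΨ.strictMono.monotone hsup
      gcongr
    · positivity
    · exact (subfactorial_pos _).le
    · exact add_nonneg (NNReal.coe_nonneg _) (subfactorial_pos _).le
    · exact Finset.prod_nonneg fun i _ => by positivity
  have hRΨ : (Ψ (R * c) : ℝ≥0∞) ≤ Ψ (K ^ 2) + oscWeight t x n := by
    have h := ENNReal.ofReal_le_ofReal (hcR R)
    rw [ENNReal.ofReal_coe_nnreal, ENNReal.ofReal_add (NNReal.coe_nonneg _) (subfactorial_pos _).le,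
      ENNReal.ofReal_coe_nnreal] at h
    refine h.trans (add_le_add le_rfl ?_)
    rcases Nat.eq_zero_or_eq_succ_pred R with h0 | h0
    · rw [h0]
      exact (ENNReal.ofReal_le_ofReal (subfactorial_mono (Nat.zero_le 1))).trans
        (subfactorial_le_oscWeight (m := 0) trivial)
    -- A ceiling `R = m + 1` guarantees only `m` oscillations, which is why `oscWeight` pairs `m`
    -- with `subfactorial (m + 1)`.
    · generalize R.pred = m at h0
      rw [h0]
      refine subfactorial_le_oscWeight ?_
      cases m with
      | zero => trivial
      | succ m =>
        have h1 : ((m + 1 : ℕ) : ℝ≥0) < U / (2 * t) := by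
          rw [← Nat.lt_ceil, ← hR, h0]; exact Nat.lt_succ_self _
        rw [lt_div_iff₀ (by positivity), hU, lt_tsub_iff_right] at h1
        obtain ⟨k, hk, hmax⟩ := exists_maxSum_eq x n
        rw [hmax] at h1
        refine (hasOscCount_of_lt_norm t.coe_nonneg m k ?_).mono hk
        have h2 : (((m + 1 : ℕ) : ℝ≥0) * (2 * t) + T : ℝ) < ‖∑ i ∈ Finset.range k, x i‖ := by
          exact_mod_cast h1
        have h3 := bigSum_mono (t : ℝ) x hk
        have h4 : (0 : ℝ) < t := by exact_mod_cast ht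
        push_cast at h2
        rw [hTbig] at h2
        linarith
  calc (Ψ (maxSum x n / (2 * (α + β))) : ℝ≥0∞) ≤ Ψ (T / α) + Ψ (R * c) := by exact_mod_cast hsum
    _ ≤ _ := add_le_add hTΨ hRΨ
    _ = _ := by ring

end Pointwise

/-! ### Expectations under independence -/

section Expectation

lemma ENNReal.prod_one_add_le_exp {ι : Type*} (s : Finset ι) (σ : ι → ℝ≥0∞) {C : ℝ≥0}
    (h : ∑ i ∈ s, σ i ≤ C) : ∏ i ∈ s, (1 + σ i) ≤ ENNReal.ofReal (Real.exp C) := by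
  have hfin : ∀ i ∈ s, σ i ≠ ∞ := fun i hi =>
    ne_top_of_le_ne_top ENNReal.coe_ne_top ((Finset.single_le_sum_of_canonicallyOrdered hi).trans h)
  have e : ∀ i ∈ s, 1 + σ i ≤ ENNReal.ofReal (Real.exp (σ i).toReal) := by
    intro i hi
    calc 1 + σ i = ENNReal.ofReal (1 + (σ i).toReal) := by
          rw [ENNReal.ofReal_add zero_le_one ENNReal.toReal_nonneg, ENNReal.ofReal_one,
            ENNReal.ofReal_toReal (hfin i hi)]
      _ ≤ _ := ENNReal.ofReal_le_ofReal (by linarith [Real.add_one_le_exp (σ i).toReal])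
  refine (Finset.prod_le_prod' e).trans ?_
  rw [← ENNReal.ofReal_prod_of_nonneg fun i _ => (Real.exp_pos _).le, ← Real.exp_sum,
    ← ENNReal.toReal_sum hfin]
  refine ENNReal.ofReal_le_ofReal (Real.exp_le_exp.2 ?_)
  exact ENNReal.toReal_mono ENNReal.coe_ne_top h

lemma measurable_finset_sup_apply {Ω : Type*} [MeasurableSpace Ω] (s : Finset ℕ)
    {f : ℕ → Ω → ℝ≥0} (hf : ∀ i, Measurable (f i)) : Measurable fun ω => s.sup fun i => f i ω := by
  induction s using Finset.cons_induction with
  | empty => simp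
  | cons i s _ ih =>
    simp only [Finset.sup_cons]
    exact (hf i).sup ih

variable {Ω F : Type*} [MeasurableSpace Ω] {μ : Measure Ω} [IsProbabilityMeasure μ]
  [NormedAddCommGroup F] [MeasurableSpace F] [BorelSpace F] {X : ℕ → Ω → F} {Ψ : ℝ≥0 → ℝ≥0}

lemma measurable_bigWeight (hΨ : IsOrliczFunction Ψ) (a t : ℝ≥0) :
    Measurable (bigWeight (F := F) Ψ a t) :=
  Measurable.ite (measurable_nnnorm measurableSet_Ioi)
    ((hΨ.strictMono.monotone.measurable.comp
      (measurable_nnnorm.div_const a)).coe_nnreal_ennreal.const_add 1) measurable_const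

/-- By independence, requiring all the other summands to be at most `t` costs a factor of at most 2.
The events that `X i` is the only large summand are disjoint, so at each point at most one weight
survives, and the maximum dominates it. -/
lemma sum_lintegral_bigWeight_le (hΨ : IsOrliczFunction Ψ) (hX : ∀ i, Measurable (X i))
    (hindep : iIndepFun X μ) {a t : ℝ≥0} {n : ℕ}
    (ht : 1 / 2 ≤ μ {ω | ∀ i < n, ‖X i ω‖₊ ≤ t}) :
    ∑ i ∈ Finset.range n, ∫⁻ ω, bigWeight Ψ a t (X i ω) ∂μ ≤
      2 * ∫⁻ ω, (1 + (Ψ ((Finset.range n).sup (fun i => ‖X i ω‖₊) / a) : ℝ≥0∞)) ∂μ := by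
  classical
  set f : F → ℝ≥0∞ := bigWeight Ψ a t with hf
  have hfm : Measurable f := measurable_bigWeight hΨ a t
  set g : F → ℝ≥0∞ := fun v => if ‖v‖₊ ≤ t then 1 else 0 with hg
  have hgm : Measurable g := Measurable.ite (measurable_nnnorm measurableSet_Iic)
    measurable_const measurable_const
  set h : ℕ → ℕ → F → ℝ≥0∞ := fun i j => if j = i then f else g with hh
  have hhm : ∀ i j, Measurable (h i j) := fun i j => by
    simp only [hh]; split_ifs <;> assumption
  have hprod : ∀ i, ∫⁻ ω, ∏ j ∈ Finset.range n, h i j (X j ω) ∂μ =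
      ∏ j ∈ Finset.range n, ∫⁻ ω, h i j (X j ω) ∂μ := fun i =>
    lintegral_prod_eq_prod_lintegral_of_indepFun _ (fun j ω => h i j (X j ω))
      (hindep.comp (h i) (hhm i)) fun j => (hhm i j).comp (hX j)
  have hgprod : ∏ j ∈ Finset.range n, ∫⁻ ω, g (X j ω) ∂μ = μ {ω | ∀ i < n, ‖X i ω‖₊ ≤ t} := by
    rw [← lintegral_prod_eq_prod_lintegral_of_indepFun _ (fun j ω => g (X j ω))
      (hindep.comp (fun _ => g) fun _ => hgm) fun j => hgm.comp (hX j)]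
    have hset : MeasurableSet {ω | ∀ i < n, ‖X i ω‖₊ ≤ t} := by
      have : {ω | ∀ i < n, ‖X i ω‖₊ ≤ t} = ⋂ (i : ℕ) (_ : i < n), {ω | ‖X i ω‖₊ ≤ t} := by
        ext ω; simp
      rw [this]
      exact MeasurableSet.iInter fun i => MeasurableSet.iInter fun _ =>
        (measurable_nnnorm.comp (hX i)) measurableSet_Iic
    rw [← lintegral_indicator_one hset]
    refine lintegral_congr fun ω => ?_
    simp only [hg, Finset.prod_ite_zero, Finset.mem_range, Finset.prod_const_one]
    rw [Set.indicator_apply]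
    simp only [Set.mem_ofPred_eq, Pi.one_apply]
  have hg1 : ∀ j, ∫⁻ ω, g (X j ω) ∂μ ≤ 1 := fun j => by
    refine (lintegral_mono fun ω => (?_ : g (X j ω) ≤ 1)).trans (by simp)
    simp only [hg]; split_ifs <;> simp
  have hlow : ∀ i ∈ Finset.range n, ∫⁻ ω, f (X i ω) ∂μ ≤
      2 * ∫⁻ ω, ∏ j ∈ Finset.range n, h i j (X j ω) ∂μ := by
    intro i hi
    rw [hprod, ← Finset.mul_prod_erase _ _ hi]
    have e1 : ∀ j ∈ (Finset.range n).erase i,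
        ∫⁻ ω, h i j (X j ω) ∂μ = ∫⁻ ω, g (X j ω) ∂μ := fun j hj => by
      simp [hh, Finset.ne_of_mem_erase hj]
    have e2 : ∫⁻ ω, h i i (X i ω) ∂μ = ∫⁻ ω, f (X i ω) ∂μ := by simp [hh]
    rw [Finset.prod_congr rfl e1, e2]
    have h1 : 1 / 2 ≤ ∏ j ∈ (Finset.range n).erase i, ∫⁻ ω, g (X j ω) ∂μ := by
      refine (ht.trans_eq hgprod.symm).trans ?_
      rw [← Finset.mul_prod_erase _ _ hi]
      exact mul_le_of_le_one_left zero_le (hg1 i)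
    calc _ = 2 * ((∫⁻ ω, f (X i ω) ∂μ) * (1 / 2)) := by
          rw [mul_comm (∫⁻ ω, f (X i ω) ∂μ) (1 / 2), ← mul_assoc, one_div,
            ENNReal.mul_inv_cancel two_ne_zero ENNReal.ofNat_ne_top, one_mul]
      _ ≤ _ := by gcongr
  calc _ ≤ ∑ i ∈ Finset.range n, 2 * ∫⁻ ω, ∏ j ∈ Finset.range n, h i j (X j ω) ∂μ :=
        Finset.sum_le_sum hlow
    _ = 2 * ∫⁻ ω, ∑ i ∈ Finset.range n, ∏ j ∈ Finset.range n, h i j (X j ω) ∂μ := by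
        rw [← Finset.mul_sum, lintegral_finsetSum]
        exact fun i _ => Finset.measurable_fun_prod _ fun j _ => (hhm i j).comp (hX j)
    _ ≤ _ := by
        gcongr with ω
        by_cases hne : ∃ i ∈ Finset.range n, ∏ j ∈ Finset.range n, h i j (X j ω) ≠ 0
        · obtain ⟨i, hi, hne⟩ := hne
          have hfi : f (X i ω) ≠ 0 := by
            have := Finset.prod_ne_zero_iff.1 hne i hi
            simpa [hh] using this
          have hbig : t < ‖X i ω‖₊ := by
            by_contra hcon
            exact hfi (by rw [hf, bigWeight, if_neg hcon])
          rw [Finset.sum_eq_single_of_mem i hi]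
          · rw [← Finset.mul_prod_erase _ _ hi]
            have h1 : ∏ j ∈ (Finset.range n).erase i, h i j (X j ω) ≤ 1 := by
              refine Finset.prod_le_one' fun j hj => ?_
              simp only [hh, if_neg (Finset.ne_of_mem_erase hj), hg]
              split_ifs <;> simp
            refine (mul_le_of_le_one_right zero_le h1).trans ?_
            simp only [hh, if_pos, hf, bigWeight, if_pos hbig]
            have h2 := Finset.le_sup (f := fun i => ‖X i ω‖₊) hi
            have h3 : Ψ (‖X i ω‖₊ / a) ≤ Ψ ((Finset.range n).sup (fun i => ‖X i ω‖₊) / a) :=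
              hΨ.strictMono.monotone (by gcongr)
            gcongr
          · intro j hj hji
            refine Finset.prod_eq_zero hi ?_
            simp only [hh, if_neg hji.symm, hg, if_neg hbig.not_ge]
        · push Not at hne
          rw [Finset.sum_eq_zero hne]
          exact zero_le

lemma lintegral_oscWeight_le (hX : ∀ i, StronglyMeasurable (X i)) (hindep : iIndepFun X μ)
    {t : ℝ} (hosc : ∀ n, μ.real {ω | HasOsc t (fun l => X l ω) 0 n} ≤ 1 / 2) (n : ℕ) :
    ∫⁻ ω, oscWeight t (fun i => X i ω) n ∂μ ≤
      ENNReal.ofReal (∑' m : ℕ, subfactorial (m + 1) * (1 / m.factorial)) := by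
  classical
  have hm : ∀ m, MeasurableSet {ω | HasOscCount t (fun i => X i ω) m n} := fun m =>
    blockAlgebra_le (fun i => (hX i).measurable) _ _ (measurableSet_hasOscCount hX t m n)
  have e : ∀ ω, oscWeight t (fun i => X i ω) n =
      ∑' m : ℕ, {ω | HasOscCount t (fun i => X i ω) m n}.indicator
        (fun _ => ENNReal.ofReal (subfactorial (m + 1))) ω := fun ω => by
    unfold oscWeight
    refine tsum_congr fun m => ?_
    rw [Set.indicator_apply]; rfl
  simp_rw [e]
  rw [lintegral_tsum fun m => (measurable_const.indicator (hm m)).aemeasurable,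
    ENNReal.ofReal_tsum_of_nonneg (fun m => mul_nonneg (subfactorial_pos _).le (by positivity))
      summable_subfactorial_div_factorial]
  refine ENNReal.tsum_le_tsum fun m => ?_
  rw [lintegral_indicator_const (hm m), ENNReal.ofReal_mul (subfactorial_pos _).le]
  gcongr
  rw [← ofReal_measureReal]
  exact ENNReal.ofReal_le_ofReal (measureReal_hasOscCount_le hX hindep hosc m n)

/-- Under (HJ), moments of the maximal summand control those of the maximal partial sum. -/
lemma exists_lintegral_maxSum_le (hΨ : IsOrliczFunction Ψ) (hHJ : SatisfiesHJ Ψ)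
    (hX : ∀ i, StronglyMeasurable (X i)) (hindep : iIndepFun X μ) {t₀ : ℝ≥0}
    (hosc : ∀ n, μ.real {ω | HasOsc t₀ (fun l => X l ω) 0 n} ≤ 1 / 2) {a : ℝ≥0} (ha : 0 < a)
    (hN : ∀ n, ∫⁻ ω, Ψ ((Finset.range n).sup (fun i => ‖X i ω‖₊) / a) ∂μ ≤ 1) :
    ∃ A : ℝ≥0, 0 < A ∧ ∃ C : ℝ≥0∞, C < ∞ ∧
      ∀ n, ∫⁻ ω, Ψ (maxSum (fun i => X i ω) n / A) ∂μ ≤ C := by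
  obtain ⟨K₀, hK₀, hHJ⟩ := hHJ
  set K : ℝ≥0 := max 1 ⟨K₀, hK₀.le⟩ with hK
  have hK1 : 1 ≤ K := le_max_left _ _
  have hKK : K₀ ≤ K := by
    have : (⟨K₀, hK₀.le⟩ : ℝ≥0) ≤ K := le_max_right _ _
    exact_mod_cast this
  have hHJ' : ∀ s u : ℝ≥0, K ≤ s → K ≤ u → orliczExponent Ψ (s * u) ≤
      K * ((s : ℝ) * Real.log (1 + (s : ℝ)) + (s : ℝ) * orliczExponent Ψ u) := by
    intro s u hs hu
    refine (hHJ s u (hKK.trans (by exact_mod_cast hs)) (hKK.trans (by exact_mod_cast hu))).trans ?_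
    have h1 := orliczExponent_nonneg Ψ u
    have h2 : 0 ≤ Real.log (1 + s) := Real.log_nonneg (by linarith [s.coe_nonneg])
    gcongr
  set t : ℝ≥0 := max t₀ (K * a) with ht
  have htosc : ∀ n, μ.real {ω | HasOsc t (fun l => X l ω) 0 n} ≤ 1 / 2 := by
    intro n
    refine le_trans (measureReal_mono ?_ (measure_ne_top μ _)) (hosc n)
    rintro ω ⟨i, j, h1, h2, h3, h4⟩
    have : (t₀ : ℝ) ≤ t := by exact_mod_cast le_max_left _ _
    exact ⟨i, j, h1, h2, h3, this.trans_lt h4⟩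
  -- A summand larger than `t` is already an oscillation, so the bound 1/2 passes to the maximal
  -- summand.
  have hsmall : ∀ n, 1 / 2 ≤ μ {ω | ∀ i < n, ‖X i ω‖₊ ≤ t} := by
    intro n
    have hm : MeasurableSet {ω | HasOsc t (fun l => X l ω) 0 n} :=
      blockAlgebra_le (fun i => (hX i).measurable) _ _ (measurableSet_hasOsc hX t 0 n)
    have hsub : {ω | HasOsc t (fun l => X l ω) 0 n}ᶜ ⊆ {ω | ∀ i < n, ‖X i ω‖₊ ≤ t} := by
      intro ω hω i hi
      by_contra hcon
      refine hω ⟨i, i + 1, Nat.zero_le _, i.le_succ, hi, ?_⟩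
      have : (t : ℝ) < ‖X i ω‖ := by exact_mod_cast not_le.1 hcon
      simpa using this
    refine le_trans ?_ (measure_mono hsub)
    rw [← ofReal_measureReal, probReal_compl_eq_one_sub hm, ENNReal.le_ofReal_iff_toReal_le]
    · have := htosc n
      simp; linarith
    · simp
    · linarith [htosc n]
  obtain ⟨A, hA, hbound⟩ := hΨ.map_maxSum_le (F := F) hK1 hHJ' ha (le_max_right t₀ (K * a))
  set D : ℝ≥0∞ := ENNReal.ofReal (∑' m : ℕ, subfactorial (m + 1) * (1 / m.factorial)) with hD
  refine ⟨A, hA, 1 + Ψ (K ^ 2) + 2 * D + ENNReal.ofReal (Real.exp (4 : ℝ≥0)), ?_, fun n => ?_⟩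
  · simp [D, ENNReal.mul_lt_top]
  have hΨm : Measurable Ψ := hΨ.strictMono.monotone.measurable
  have hnm : ∀ i, Measurable fun ω => ‖X i ω‖₊ := fun i => (hX i).nnnorm.measurable
  have hsupm : Measurable fun ω => (Finset.range n).sup (fun i => ‖X i ω‖₊) :=
    measurable_finset_sup_apply _ hnm
  have hNm : Measurable fun ω => (Ψ ((Finset.range n).sup (fun i => ‖X i ω‖₊) / a) : ℝ≥0∞) :=
    (hΨm.comp (hsupm.div_const a)).coe_nnreal_ennreal
  have hwm : Measurable fun v : F => 1 + bigWeight Ψ a t v := (measurable_bigWeight hΨ a t).const_add 1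
  have hPm : Measurable fun ω => ∏ i ∈ Finset.range n, (1 + bigWeight Ψ a t (X i ω)) :=
    Finset.measurable_fun_prod _ fun i _ => hwm.comp (hX i).measurable
  have hprod : ∫⁻ ω, ∏ i ∈ Finset.range n, (1 + bigWeight Ψ a t (X i ω)) ∂μ ≤
      ENNReal.ofReal (Real.exp (4 : ℝ≥0)) := by
    rw [lintegral_prod_eq_prod_lintegral_of_indepFun _ (fun i ω => 1 + bigWeight Ψ a t (X i ω))
      (hindep.comp (fun _ v => 1 + bigWeight Ψ a t v) fun _ => hwm)
      fun i => hwm.comp (hX i).measurable]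
    have e : ∀ i, ∫⁻ ω, (1 + bigWeight Ψ a t (X i ω)) ∂μ =
        1 + ∫⁻ ω, bigWeight Ψ a t (X i ω) ∂μ := fun i => by
      rw [lintegral_add_left measurable_const]; simp
    simp_rw [e]
    refine ENNReal.prod_one_add_le_exp _ _ ?_
    refine (sum_lintegral_bigWeight_le hΨ (fun i => (hX i).measurable) hindep (hsmall n)).trans ?_
    rw [lintegral_add_left measurable_const]
    calc _ ≤ 2 * ((1 : ℝ≥0∞) + 1) := by
          gcongr
          · simp
          · exact hN n
      _ = _ := by norm_num
  calc ∫⁻ ω, Ψ (maxSum (fun i => X i ω) n / A) ∂μ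
      ≤ ∫⁻ ω, (Ψ ((Finset.range n).sup (fun i => ‖X i ω‖₊) / a) + Ψ (K ^ 2) +
        2 * oscWeight t (fun i => X i ω) n +
        ∏ i ∈ Finset.range n, (1 + bigWeight Ψ a t (X i ω))) ∂μ :=
        lintegral_mono fun ω => hbound (fun i => X i ω) n
    _ = ∫⁻ ω, Ψ ((Finset.range n).sup (fun i => ‖X i ω‖₊) / a) ∂μ + Ψ (K ^ 2) +
        2 * ∫⁻ ω, oscWeight t (fun i => X i ω) n ∂μ +
        ∫⁻ ω, ∏ i ∈ Finset.range n, (1 + bigWeight Ψ a t (X i ω)) ∂μ := by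
        rw [lintegral_add_right _ hPm, lintegral_add_left (hNm.add_const _),
          lintegral_add_right _ measurable_const, lintegral_const_mul' _ _ ENNReal.ofNat_ne_top]
        simp
    _ ≤ _ := by
        gcongr
        · exact hN n
        · exact lintegral_oscWeight_le hX hindep htosc n

end Expectation

/-! ### The equivalence -/

section Equivalence

lemma iSup_enorm_partialSum {Ω F : Type*} [NormedAddCommGroup F]
    (X : ℕ → Ω → F) (ω : Ω) :
    ⨆ n, ‖partialSum X n ω‖ₑ = ⨆ n, (maxSum (fun i => X i ω) n : ℝ≥0∞) := by
  refine le_antisymm (iSup_le fun n => ?_) (iSup_le fun n => ?_)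
  · refine le_trans ?_ (le_iSup (fun n => (maxSum (fun i => X i ω) n : ℝ≥0∞)) (n + 1))
    rw [enorm_eq_nnnorm]
    exact_mod_cast norm_le_maxSum (fun i => X i ω) le_rfl
  · obtain ⟨k, -, hk⟩ := exists_maxSum_eq (fun i => X i ω) n
    rw [hk]
    cases k with
    | zero => simp
    | succ k =>
      rw [← enorm_eq_nnnorm]
      exact le_iSup (fun n => ‖partialSum X n ω‖ₑ) k

variable {Ω F : Type*} [MeasurableSpace Ω] {μ : Measure Ω} [NormedAddCommGroup F]
  {X : ℕ → Ω → F} {Ψ : ℝ≥0 → ℝ≥0}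

lemma measurable_maxSum (hX : ∀ i, StronglyMeasurable (X i)) (n : ℕ) :
    Measurable fun ω => maxSum (fun i => X i ω) n :=
  measurable_finset_sup_apply _ fun k =>
    (Finset.stronglyMeasurable_fun_sum (Finset.range k) fun i _ => hX i).nnnorm.measurable

variable [IsProbabilityMeasure μ]

lemma StochasticallyBounded.exists_forall_range
    (h : StochasticallyBounded (partialSum X) μ) {ε : ℝ} (hε : 0 < ε) :
    ∃ K : ℝ≥0, ∀ n, μ.real {ω | (K : ℝ) < ‖∑ i ∈ Finset.range n, X i ω‖} ≤ ε := by
  obtain ⟨K, hK, hb⟩ := h ε hε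
  refine ⟨K.toNNReal, fun n => ?_⟩
  rw [Real.coe_toNNReal _ hK.le]
  cases n with
  | zero => simpa [hK.not_gt] using hε.le
  | succ n =>
    refine (measureReal_mono (fun ω hω => ?_) (measure_ne_top μ _)).trans (hb n).le
    exact le_of_lt (Set.mem_ofPred_eq ▸ hω)

lemma StochasticallyBounded.exists_forall_Ico (h : StochasticallyBounded (partialSum X) μ) :
    ∃ r : ℝ≥0, ∀ n, ∀ k ≤ n, μ.real {ω | (r : ℝ) < ‖∑ i ∈ Finset.Ico k n, X i ω‖} ≤ 1 / 2 := by
  obtain ⟨K, hK⟩ := h.exists_forall_range (ε := 1 / 4) (by norm_num)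
  refine ⟨2 * K, fun n k hk => ?_⟩
  have hsub : {ω | ((2 * K : ℝ≥0) : ℝ) < ‖∑ i ∈ Finset.Ico k n, X i ω‖} ⊆
      {ω | (K : ℝ) < ‖∑ i ∈ Finset.range n, X i ω‖} ∪
        {ω | (K : ℝ) < ‖∑ i ∈ Finset.range k, X i ω‖} := by
    intro ω hω
    by_contra hcon
    simp only [Set.mem_union, Set.mem_ofPred_eq, not_or, not_lt] at hcon hω
    rw [Finset.sum_Ico_eq_sub _ hk] at hω
    push_cast at hω
    linarith [norm_sub_le (∑ i ∈ Finset.range n, X i ω) (∑ i ∈ Finset.range k, X i ω)]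
  linarith [(measureReal_mono hsub (measure_ne_top μ _)).trans (measureReal_union_le _ _), hK n, hK k]

variable [MeasurableSpace F] [BorelSpace F]

/-- A block sum is a difference of two partial sums, and by Ottaviani all of these are at most `K +
r` outside an event of probability `2 * (1 / 4)`. -/
lemma StochasticallyBounded.exists_hasOsc_le (h : StochasticallyBounded (partialSum X) μ)
    (hX : ∀ i, StronglyMeasurable (X i)) (hindep : iIndepFun X μ) :
    ∃ t : ℝ≥0, ∀ n, μ.real {ω | HasOsc t (fun l => X l ω) 0 n} ≤ 1 / 2 := by
  obtain ⟨r, hr⟩ := h.exists_forall_Ico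
  obtain ⟨K, hK⟩ := h.exists_forall_range (ε := 1 / 4) (by norm_num)
  refine ⟨2 * (K + r), fun n => ?_⟩
  have hott := ottaviani hX hindep (hr n) (isUpperSet_Ioi K)
  have hsub : {ω | HasOsc ((2 * (K + r) : ℝ≥0) : ℝ) (fun l => X l ω) 0 n} ⊆
      {ω | ∃ k ≤ n, ‖∑ i ∈ Finset.range k, X i ω‖₊ - r ∈ Set.Ioi K} := by
    rintro ω ⟨a, b, -, hab, hbn, hlt⟩
    by_contra hcon
    simp only [Set.mem_ofPred_eq, not_exists, not_and, Set.mem_Ioi, not_lt] at hcon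
    have hall : ∀ k ≤ n, ‖∑ i ∈ Finset.range k, X i ω‖ ≤ K + r := fun k hk => by
      have := tsub_le_iff_right.1 (hcon k hk)
      exact_mod_cast this
    rw [Finset.sum_Ico_eq_sub _ hab] at hlt
    push_cast at hlt
    linarith [norm_sub_le (∑ i ∈ Finset.range b, X i ω) (∑ i ∈ Finset.range a, X i ω),
      hall b hbn, hall a (hab.trans hbn)]
  have h2 : μ.real {ω | ‖∑ i ∈ Finset.range n, X i ω‖₊ ∈ Set.Ioi K} ≤ 1 / 4 := by
    refine le_trans (measureReal_mono (fun ω hω => ?_) (measure_ne_top μ _)) (hK n)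
    exact NNReal.coe_lt_coe.2 hω
  linarith [measureReal_mono hsub (measure_ne_top μ _)]

/-- The integrated form of Ottaviani's inequality. -/
lemma lintegral_maxSum_sub_le (hX : ∀ i, StronglyMeasurable (X i)) (hindep : iIndepFun X μ)
    {r : ℝ≥0} {n : ℕ}
    (hr : ∀ k ≤ n, μ.real {ω | (r : ℝ) < ‖∑ i ∈ Finset.Ico k n, X i ω‖} ≤ 1 / 2)
    {Φ : ℝ≥0 → ℝ≥0} (hΦ : Monotone Φ) :
    ∫⁻ ω, Φ (maxSum (fun i => X i ω) n - r) ∂μ ≤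
      2 * ∫⁻ ω, Φ ‖∑ i ∈ Finset.range n, X i ω‖₊ ∂μ := by
  have hΦm : Measurable Φ := hΦ.measurable
  have hm1 : Measurable fun ω => (Φ (maxSum (fun i => X i ω) n - r) : ℝ) :=
    (hΦm.comp ((measurable_maxSum hX n).sub_const r)).coe_nnreal_real
  have hm2 : Measurable fun ω => (Φ ‖∑ i ∈ Finset.range n, X i ω‖₊ : ℝ) :=
    (hΦm.comp (Finset.stronglyMeasurable_fun_sum (Finset.range n)
      fun i _ => hX i).nnnorm.measurable).coe_nnreal_real
  have h1 := lintegral_eq_lintegral_meas_lt μ (ae_of_all _ fun ω => NNReal.coe_nonneg _)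
    hm1.aemeasurable
  have h2 := lintegral_eq_lintegral_meas_lt μ (ae_of_all _ fun ω => NNReal.coe_nonneg _)
    hm2.aemeasurable
  simp only [ENNReal.ofReal_coe_nnreal] at h1 h2
  rw [h1, h2, ← lintegral_const_mul' _ _ ENNReal.ofNat_ne_top]
  refine lintegral_mono fun u => ?_
  -- Layer cake: superlevel sets of a monotone `Φ` are upper sets, so Ottaviani applies at every
  -- level `u`.
  have hU : IsUpperSet {y : ℝ≥0 | u < (Φ y : ℝ)} := fun y z hyz hy =>
    lt_of_lt_of_le hy (NNReal.coe_le_coe.2 (hΦ hyz))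
  have h3 := ottaviani hX hindep hr hU
  have hsub : {ω | u < (Φ (maxSum (fun i => X i ω) n - r) : ℝ)} ⊆
      {ω | ∃ k ≤ n, ‖∑ i ∈ Finset.range k, X i ω‖₊ - r ∈ {y : ℝ≥0 | u < (Φ y : ℝ)}} := by
    intro ω hω
    obtain ⟨k, hk, hmax⟩ := exists_maxSum_eq (fun i => X i ω) n
    refine ⟨k, hk, ?_⟩
    rw [← hmax]; exact hω
  have h4 := (measureReal_mono hsub (measure_ne_top μ _)).trans h3
  have h5 := ENNReal.ofReal_le_ofReal h4
  rw [ENNReal.ofReal_mul zero_le_two, ofReal_measureReal, ofReal_measureReal] at h5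
  simpa using h5

end Equivalence

theorem theorem4p8 {Ω F : Type*} [MeasurableSpace Ω] (μ : Measure Ω) [IsProbabilityMeasure μ]
    [NormedAddCommGroup F] [NormedSpace ℝ F] [CompleteSpace F] [MeasurableSpace F] [BorelSpace F]
    (Ψ : ℝ≥0 → ℝ≥0) (hΨ : IsOrliczFunction Ψ) (hHJ : SatisfiesHJ Ψ)
    (X : ℕ → Ω → F) (hX : ∀ n, StronglyMeasurable (X n)) (hindep : iIndepFun X μ)
    (hbdd : StochasticallyBounded (partialSum X) μ) :
    List.TFAE
      [BoundedInOrlicz Ψ (partialSum X) μ,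
        MemOrlicz Ψ (fun ω => ⨆ n, ‖X n ω‖ₑ) μ,
        MemOrlicz Ψ (fun ω => ⨆ n, ‖partialSum X n ω‖ₑ) μ] := by
  have hmono : Monotone fun n ω => maxSum (fun i => X i ω) n := fun m n hmn ω => maxSum_mono _ hmn
  have hS : ∀ n, StronglyMeasurable (partialSum X n) := fun n =>
    Finset.stronglyMeasurable_fun_sum _ fun i _ => hX i
  tfae_have 3 → 1 := by
    rintro ⟨-, h⟩
    obtain ⟨C, hC⟩ := ENNReal.lt_iff_exists_coe.1 h
    have hle : ∀ n, eOrliczNorm Ψ (partialSum X n) μ ≤ C := fun n => by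
      rw [← hC.1]
      refine eOrliczNorm_mono hΨ fun ω => ?_
      rw [enorm_eq_self]
      exact le_iSup (fun n => ‖partialSum X n ω‖ₑ) n
    exact ⟨C, fun n => ⟨⟨hS n, (hle n).trans_lt ENNReal.coe_lt_top⟩, hle n⟩⟩
  tfae_have 3 → 2 := by
    rintro ⟨-, h⟩
    obtain ⟨a, ha, -⟩ := ENNReal.lt_iff_exists_nnreal_btwn.1 h
    obtain ⟨ha0, ha1⟩ := lintegral_orliczExtend_le_one hΨ ha
    refine ⟨(Measurable.iSup fun n => (hX n).enorm).stronglyMeasurable,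
      eOrliczNorm_lt_top hΨ (a := 2 * a) (by positivity) (lt_of_le_of_lt ?_ ENNReal.one_lt_top)⟩
    refine (lintegral_mono fun ω => hΨ.orliczExtend_mono ?_).trans ha1
    simp only [enorm_eq_self]
    have hle : ⨆ n, ‖X n ω‖ₑ ≤ 2 * ⨆ n, ‖partialSum X n ω‖ₑ := by
      refine iSup_le fun n => ?_
      have hn := le_iSup (fun n => ‖partialSum X n ω‖ₑ) n
      cases n with
      | zero =>
        simp only [partialSum, zero_add, Finset.sum_range_one] at hn ⊢
        exact hn.trans (le_mul_of_one_le_left zero_le one_le_two)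
      | succ n =>
        have hn' := le_iSup (fun n => ‖partialSum X n ω‖ₑ) n
        have e : X (n + 1) ω = partialSum X (n + 1) ω - partialSum X n ω := by
          simp [partialSum, Finset.sum_range_succ _ (n + 1)]
        rw [e, two_mul]
        exact enorm_sub_le.trans (add_le_add hn hn')
    calc _ ≤ 2 * (⨆ n, ‖partialSum X n ω‖ₑ) / ((2 * a : ℝ≥0) : ℝ≥0∞) :=
          ENNReal.div_le_div_right hle _
      _ = _ := by
          push_cast
          exact ENNReal.mul_div_mul_left _ _ two_ne_zero ENNReal.ofNat_ne_top
  tfae_have 2 → 3 := by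
    rintro ⟨-, h⟩
    obtain ⟨a, ha, -⟩ := ENNReal.lt_iff_exists_nnreal_btwn.1 h
    obtain ⟨ha0, ha1⟩ := lintegral_orliczExtend_le_one hΨ ha
    obtain ⟨t, ht⟩ := hbdd.exists_hasOsc_le hX hindep
    obtain ⟨A, hA, C, hC, hb⟩ := exists_lintegral_maxSum_le hΨ hHJ hX hindep ht ha0 fun n => by
      refine (lintegral_mono fun ω => ?_).trans ha1
      rw [← orliczExtend_coe, ENNReal.coe_div ha0.ne', enorm_eq_self]
      refine hΨ.orliczExtend_mono (ENNReal.div_le_div_right ?_ _)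
      rw [ENNReal.coe_finset_sup]
      exact Finset.sup_le fun i _ => le_iSup (fun n => ‖X n ω‖ₑ) i
    exact memOrlicz_of_monotone hΨ (measurable_maxSum hX) hmono (iSup_enorm_partialSum X) hA hC hb
  tfae_have 1 → 3 := by
    rintro ⟨C, hC⟩
    obtain ⟨r, hr⟩ := hbdd.exists_forall_Ico
    -- The scale `C + 1` is strictly above the norms, so attainment of the infimum is not needed.
    have hlt : (C : ℝ≥0∞) < (C + 1 : ℝ≥0) := by exact_mod_cast lt_add_one C
    have hC1 : (0 : ℝ≥0) < C + 1 := by positivity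
    have hS1 : ∀ n, ∫⁻ ω, Ψ (‖∑ i ∈ Finset.range n, X i ω‖₊ / (C + 1)) ∂μ ≤ 1 := by
      intro n
      cases n with
      | zero => simp [hΨ.map_zero]
      | succ n =>
        refine le_trans (lintegral_mono fun ω => ?_)
          (lintegral_orliczExtend_le_one hΨ ((hC n).2.trans_lt hlt)).2
        rw [orliczExtend_enorm_div _ _ hC1]
        rfl
    refine memOrlicz_of_monotone hΨ (measurable_maxSum hX) hmono (iSup_enorm_partialSum X)
      (A := 2 * (C + 1)) (by positivity) (C := 2 * 1 + Ψ (r / (C + 1))) (by simp) fun n => ?_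
    have hΦ : Monotone fun y : ℝ≥0 => Ψ (y / (C + 1)) := fun y z hyz =>
      hΨ.strictMono.monotone (by gcongr)
    have h1 := lintegral_maxSum_sub_le hX hindep (hr n) hΦ
    calc _ ≤ ∫⁻ ω, ((Ψ ((maxSum (fun i => X i ω) n - r) / (C + 1)) : ℝ≥0∞) +
            Ψ (r / (C + 1))) ∂μ := by
          refine lintegral_mono fun ω => ?_
          have h2 : maxSum (fun i => X i ω) n / (2 * (C + 1)) ≤
              ((maxSum (fun i => X i ω) n - r) / (C + 1) + r / (C + 1)) / 2 := by
            rw [← add_div, div_div, mul_comm 2]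
            gcongr
            exact le_tsub_add
          have h3 := (hΨ.strictMono.monotone h2).trans (hΨ.map_half_add_le _ _)
          rw [← ENNReal.coe_add]
          exact ENNReal.coe_le_coe.2 h3
      _ = ∫⁻ ω, Ψ ((maxSum (fun i => X i ω) n - r) / (C + 1)) ∂μ + Ψ (r / (C + 1)) := by
          rw [lintegral_add_right _ measurable_const]; simp
      _ ≤ _ := by
          gcongr
          exact h1.trans (by gcongr; exact hS1 n)
  tfae_finish
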